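/- Let $k$ be a field; algebras are associative and unital and $\otimes=\otimes_k$. A triple $(A,B,\varepsilon)$ consists of a $k$-algebra $A$, a commutative $k$-algebra $B$ and a morphism of $k$-algebras $\varepsilon:B\to A$ with image in the center of $A$. An $A$-bimodule $M$ (with $k$ acting in the same way from both sides) is $B$-symmetric if $m\varepsilon(\alpha)=\varepsilon(\alpha)m$ for all $m\in M$, $\alpha\in B$. For such an $M$, the secondary Hochschild homology $H_\bullet((A,B,\varepsilon);M)$ is the homology of the complex with $C_n=M\otimes A^{\otimes n}\otimes B^{\otimes n(n-1)/2}$, $n\ge 0$. Write an elementary chain as $m\otimes(a_i,b_{i,j})$, with $a_1,\dots,a_n\in A$ on the diagonal and $b_{i,j}\in B$ $(1\le i<j\le n)$ above the diagonal of an $n\times n$ matrix. The boundary is $\partial_n=\sum_{i=0}^n(-1)^i d_i:C_n\to C_{n-1}$ $(n\ge 1)$, where $d_0$ replaces $m$ by $m a_1\varepsilon(b_{1,2}b_{1,3}\cdots b_{1,n})$ and deletes the first row and column; $d_n$ replaces $m$ by $a_n\varepsilon(b_{1,n}b_{2,n}\cdots b_{n-1,n})m$ and deletes the last row and column; and $d_i$,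 for $0<i<n$, keeps $m$ and merges rows and columns $i$ and $i+1$: the new diagonal entry is $a_i\varepsilon(b_{i,i+1})a_{i+1}$, entries $b_{r,i}$ and $b_{r,i+1}$ $(r<i)$ are replaced by $b_{r,i}b_{r,i+1}$, entries $b_{i,s}$ and $b_{i+1,s}$ $(s>i+1)$ by $b_{i,s}b_{i+1,s}$, and all other entries are kept. A Morita equivalence of triples $(P,Q,\eta)$ between $(A,B,\varepsilon)$ and $(A',B',\varepsilon')$ consists of an $A$-$A'$-bimodule $P$ and an $A'$-$A$-bimodule $Q$ such that $P\otimes_{A'}Q\cong A$ as $A$-bimodules and $Q\otimes_A P\cong A'$ as $A'$-bimodules, and of an isomorphism of $k$-algebras $\eta:B\to B'$, such that $$\varepsilon(\alpha)p=p\,\varepsilon'(\eta(\alpha))\quad\text{and}\quad q\,\varepsilon(\alpha)=\varepsilon'(\eta(\alpha))\,q\qquad(p\in P,\ q\in Q,\ \alpha\in B).$$ For every $B$-symmetric $A$-bimodule $M$, the $A'$-bimodule $Q\otimes_A M\otimes_A P$ is then $B'$-symmetric. **Theorem.** If $(P,Q,\eta)$ is a Morita equivalence of triples between $(A,B,\varepsilon)$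 and $(A',B',\varepsilon')$, then in every degree $n\ge 0$ there is an isomorphism of $k$-vector spaces $$H_n((A,B,\varepsilon);M)\cong H_n((A',B',\varepsilon');Q\otimes_A M\otimes_A P),$$ natural in the $B$-symmetric $A$-bimodule $M$: for every morphism $u:M\to N$ of such bimodules, these isomorphisms commute with the maps on homology induced by $u$ and by $\mathrm{id}_Q\otimes u\otimes\mathrm{id}_P$. -/

import Mathlib

universe uk uA uB uA' uB' uP uQ uM uN ur us ut ux uy

namespace SecHH

open scoped TensorProduct

/-! ### Bimodules over associative algebras -/

/-- An `R`-`S`-bimodule over the commutative ring `k`: left and right actions (the right action is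
an action of `Sᵐᵒᵖ`) that commute, on which `k` acts in the same way from both sides. -/
structure Bimodule (k : Type uk) (R : Type ur) (S : Type us) [CommRing k] [Ring R] [Ring S]
    [Algebra k R] [Algebra k S] where
  /-- the underlying `k`-module -/
  carrier : Type ux
  [addCommGroup : AddCommGroup carrier]
  [module : Module k carrier]
  [leftModule : Module R carrier]
  [rightModule : Module Sᵐᵒᵖ carrier]
  [leftTower : IsScalarTower k R carrier]
  [rightTower : IsScalarTower k Sᵐᵒᵖ carrier]
  [smulComm : SMulCommClass R Sᵐᵒᵖ carrier]

attribute [instance] Bimodule.addCommGroup Bimodule.module Bimodule.leftModule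
  Bimodule.rightModule Bimodule.leftTower Bimodule.rightTower Bimodule.smulComm

section Bimodules

variable {k : Type uk} {R : Type ur} {S : Type us} {T : Type ut} [CommRing k] [Ring R] [Ring S]
  [Ring T] [Algebra k R] [Algebra k S] [Algebra k T]

/-- Morphisms of bimodules. -/
structure Bimodule.Hom (X : Bimodule.{uk, ur, us, ux} k R S)
    (Y : Bimodule.{uk, ur, us, uy} k R S) where
  /-- the underlying `k`-linear map -/
  toLin : X.carrier →ₗ[k] Y.carrier
  map_left : ∀ (r : R) (x : X.carrier), toLin (r • x) = r • toLin x
  map_right : ∀ (s : S) (x : X.carrier),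
    toLin (MulOpposite.op s • x) = MulOpposite.op s • toLin x

/-- Isomorphisms of bimodules. -/
structure Bimodule.Iso (X : Bimodule.{uk, ur, us, ux} k R S)
    (Y : Bimodule.{uk, ur, us, uy} k R S) where
  /-- the underlying `k`-linear equivalence -/
  toLin : X.carrier ≃ₗ[k] Y.carrier
  map_left : ∀ (r : R) (x : X.carrier), toLin (r • x) = r • toLin x
  map_right : ∀ (s : S) (x : X.carrier),
    toLin (MulOpposite.op s • x) = MulOpposite.op s • toLin x

variable (k R) in
/-- The algebra `R` as a bimodule over itself, by left and right multiplication. -/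
abbrev Bimodule.regular : Bimodule.{uk, ur, ur, ur} k R R where
  carrier := R

/-- The relations `x s ⊗ y = x ⊗ s y` in `X ⊗[k] Y`. -/
def Bimodule.tensorRel (X : Bimodule.{uk, ur, us, ux} k R S)
    (Y : Bimodule.{uk, us, ut, uy} k S T) : Submodule k (X.carrier ⊗[k] Y.carrier) :=
  Submodule.span k
    {z | ∃ (x : X.carrier) (s : S) (y : Y.carrier),
      z = (MulOpposite.op s • x) ⊗ₜ[k] y - x ⊗ₜ[k] (s • y)}

/-- The underlying `k`-module of the balanced tensor product of `X` and `Y` over `S`. -/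
abbrev Bimodule.TensorCarrier (X : Bimodule.{uk, ur, us, ux} k R S)
    (Y : Bimodule.{uk, us, ut, uy} k S T) : Type (max ux uy) :=
  (X.carrier ⊗[k] Y.carrier) ⧸ X.tensorRel Y

/-- The class of `x ⊗ y` in the balanced tensor product over `S`. -/
def Bimodule.tmul {X : Bimodule.{uk, ur, us, ux} k R S} {Y : Bimodule.{uk, us, ut, uy} k S T}
    (x : X.carrier) (y : Y.carrier) : X.TensorCarrier Y :=
  (X.tensorRel Y).mkQ (x ⊗ₜ[k] y)

section Balanced

variable {X : Bimodule.{uk, ur, us, ux} k R S} {Y : Bimodule.{uk, us, ut, uy} k S T}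

theorem Bimodule.smul_tmul (x : X.carrier) (s : S) (y : Y.carrier) :
    (Bimodule.tmul (MulOpposite.op s • x) y : X.TensorCarrier Y) = Bimodule.tmul x (s • y) :=
  (Submodule.Quotient.eq _).2 (Submodule.subset_span ⟨x, s, y, rfl⟩)

theorem Bimodule.add_tmul (x x' : X.carrier) (y : Y.carrier) :
    (Bimodule.tmul (x + x') y : X.TensorCarrier Y) = Bimodule.tmul x y + Bimodule.tmul x' y := by
  simp only [Bimodule.tmul, TensorProduct.add_tmul, map_add]

theorem Bimodule.tmul_add (x : X.carrier) (y y' : Y.carrier) :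
    (Bimodule.tmul x (y + y') : X.TensorCarrier Y) = Bimodule.tmul x y + Bimodule.tmul x y' := by
  simp only [Bimodule.tmul, TensorProduct.tmul_add, map_add]

theorem Bimodule.ksmul_tmul (c : k) (x : X.carrier) (y : Y.carrier) :
    (Bimodule.tmul (c • x) y : X.TensorCarrier Y) = c • Bimodule.tmul x y := by
  simp only [Bimodule.tmul, ← map_smul, TensorProduct.smul_tmul']

theorem Bimodule.tmul_ksmul (c : k) (x : X.carrier) (y : Y.carrier) :
    (Bimodule.tmul x (c • y) : X.TensorCarrier Y) = c • Bimodule.tmul x y := by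
  simp only [Bimodule.tmul, ← map_smul, TensorProduct.tmul_smul]

/-- Linear maps out of the balanced tensor product that agree on all `x ⊗ y` are equal. -/
theorem Bimodule.tensor_ext {Z : Type*} [AddCommGroup Z] [Module k Z]
    {F G : X.TensorCarrier Y →ₗ[k] Z}
    (h : ∀ (x : X.carrier) (y : Y.carrier), F (Bimodule.tmul x y) = G (Bimodule.tmul x y)) :
    F = G :=
  Submodule.linearMap_qext _ (TensorProduct.ext' h)

/-- The map of balanced tensor products induced by a right `S`-linear and a left `S`-linear map. -/
def Bimodule.tensorMap {R' : Type*} {T' : Type*} [Ring R'] [Ring T'] [Algebra k R'] [Algebra k T']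
    {X' : Bimodule k R' S} {Y' : Bimodule k S T'}
    (F : X.carrier →ₗ[k] X'.carrier) (G : Y.carrier →ₗ[k] Y'.carrier)
    (hF : ∀ (s : S) (x : X.carrier), F (MulOpposite.op s • x) = MulOpposite.op s • F x)
    (hG : ∀ (s : S) (y : Y.carrier), G (s • y) = s • G y) :
    X.TensorCarrier Y →ₗ[k] X'.TensorCarrier Y' :=
  Submodule.mapQ _ _ (TensorProduct.map F G) (by
    refine Submodule.span_le.2 ?_
    rintro _ ⟨x, s, y, rfl⟩
    refine Submodule.subset_span ⟨F x, s, G y, ?_⟩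
    simp only [map_sub, TensorProduct.map_tmul, hF, hG])

theorem Bimodule.tensorMap_tmul {R' : Type*} {T' : Type*} [Ring R'] [Ring T'] [Algebra k R']
    [Algebra k T'] {X' : Bimodule k R' S} {Y' : Bimodule k S T'}
    (F : X.carrier →ₗ[k] X'.carrier) (G : Y.carrier →ₗ[k] Y'.carrier)
    (hF : ∀ (s : S) (x : X.carrier), F (MulOpposite.op s • x) = MulOpposite.op s • F x)
    (hG : ∀ (s : S) (y : Y.carrier), G (s • y) = s • G y) (x : X.carrier) (y : Y.carrier) :
    Bimodule.tensorMap F G hF hG (Bimodule.tmul x y) = Bimodule.tmul (F x) (G y) := rfl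

variable (X Y)

/-- The left action of `R` on `X ⊗ Y` through `X`. -/
def Bimodule.leftEnd : R →ₐ[k] Module.End k (X.TensorCarrier Y) :=
  AlgHom.ofLinearMap
    { toFun := fun r => Bimodule.tensorMap (X := X) (Y := Y) (Algebra.lsmul k k X.carrier r)
        LinearMap.id (fun s x => smul_comm r (MulOpposite.op s) x) (fun _ _ => rfl)
      map_add' := fun r r' => Bimodule.tensor_ext fun x y => by
        change Bimodule.tmul ((r + r') • x) y = Bimodule.tmul (r • x) y + Bimodule.tmul (r' • x) y
        rw [add_smul, Bimodule.add_tmul]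
      map_smul' := fun c r => Bimodule.tensor_ext fun x y => by
        change Bimodule.tmul ((c • r) • x) y = c • Bimodule.tmul (r • x) y
        rw [smul_assoc, Bimodule.ksmul_tmul] }
    (Bimodule.tensor_ext fun x y => by
      change Bimodule.tmul ((1 : R) • x) y = Bimodule.tmul x y
      rw [one_smul])
    (fun r r' => Bimodule.tensor_ext fun x y => by
      change Bimodule.tmul ((r * r') • x) y = Bimodule.tmul (r • r' • x) y
      rw [mul_smul])

/-- The right action of `T` on `X ⊗ Y` through `Y`. -/
def Bimodule.rightEnd : Tᵐᵒᵖ →ₐ[k] Module.End k (X.TensorCarrier Y) :=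
  AlgHom.ofLinearMap
    { toFun := fun t => Bimodule.tensorMap (X := X) (Y := Y) LinearMap.id
        (Algebra.lsmul k k Y.carrier t) (fun _ _ => rfl) (fun s y => (smul_comm s t y).symm)
      map_add' := fun t t' => Bimodule.tensor_ext fun x y => by
        change Bimodule.tmul x ((t + t') • y) = Bimodule.tmul x (t • y) + Bimodule.tmul x (t' • y)
        rw [add_smul, Bimodule.tmul_add]
      map_smul' := fun c t => Bimodule.tensor_ext fun x y => by
        change Bimodule.tmul x ((c • t) • y) = c • Bimodule.tmul x (t • y)
        rw [smul_assoc, Bimodule.tmul_ksmul] }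
    (Bimodule.tensor_ext fun x y => by
      change Bimodule.tmul x ((1 : Tᵐᵒᵖ) • y) = Bimodule.tmul x y
      rw [one_smul])
    (fun t t' => Bimodule.tensor_ext fun x y => by
      change Bimodule.tmul x ((t * t') • y) = Bimodule.tmul x (t • t' • y)
      rw [mul_smul])

/-- The balanced tensor product over `S` of an `R`-`S`-bimodule and an `S`-`T`-bimodule, with
`r (x ⊗ y) t = r x ⊗ y t`. -/
def Bimodule.tensor : Bimodule.{uk, ur, ut, max ux uy} k R T :=
  letI : Module R (X.TensorCarrier Y) := Module.compHom _ (Bimodule.leftEnd X Y).toRingHom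
  letI : Module Tᵐᵒᵖ (X.TensorCarrier Y) := Module.compHom _ (Bimodule.rightEnd X Y).toRingHom
  { carrier := X.TensorCarrier Y
    leftTower := ⟨fun c r z =>
      LinearMap.congr_fun (map_smul (Bimodule.leftEnd X Y) c r) z⟩
    rightTower := ⟨fun c t z =>
      LinearMap.congr_fun (map_smul (Bimodule.rightEnd X Y) c t) z⟩
    smulComm := ⟨fun r t z => by
      have h : (Bimodule.leftEnd X Y r).comp (Bimodule.rightEnd X Y t) =
          (Bimodule.rightEnd X Y t).comp (Bimodule.leftEnd X Y r) :=
        Bimodule.tensor_ext fun x y => rfl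
      exact LinearMap.congr_fun h z⟩ }

variable {X Y}

theorem Bimodule.left_smul_tmul (r : R) (x : X.carrier) (y : Y.carrier) :
    letI z : (X.tensor Y).carrier := (Bimodule.tmul x y : X.TensorCarrier Y)
    r • z = (Bimodule.tmul (r • x) y : X.TensorCarrier Y) := rfl

theorem Bimodule.right_smul_tmul (t : T) (x : X.carrier) (y : Y.carrier) :
    letI z : (X.tensor Y).carrier := (Bimodule.tmul x y : X.TensorCarrier Y)
    MulOpposite.op t • z = (Bimodule.tmul x (MulOpposite.op t • y) : X.TensorCarrier Y) := rfl

/-- The morphism `u ⊗ v` of balanced tensor products induced by bimodule morphisms `u`, `v`. -/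
def Bimodule.Hom.tensor {X' : Bimodule k R S} {Y' : Bimodule k S T}
    (u : Bimodule.Hom X X') (v : Bimodule.Hom Y Y') :
    Bimodule.Hom (X.tensor Y) (X'.tensor Y') where
  toLin := Bimodule.tensorMap u.toLin v.toLin u.map_right v.map_left
  map_left r z := by
    have h : (Bimodule.tensorMap u.toLin v.toLin u.map_right v.map_left).comp
        (Bimodule.leftEnd X Y r) = (Bimodule.leftEnd X' Y' r).comp
        (Bimodule.tensorMap u.toLin v.toLin u.map_right v.map_left) :=
      Bimodule.tensor_ext fun x y =>
        congrArg (fun w => (Bimodule.tmul w (v.toLin y) : X'.TensorCarrier Y')) (u.map_left r x)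
    exact LinearMap.congr_fun h z
  map_right t z := by
    have h : (Bimodule.tensorMap u.toLin v.toLin u.map_right v.map_left).comp
        (Bimodule.rightEnd X Y (MulOpposite.op t)) =
        (Bimodule.rightEnd X' Y' (MulOpposite.op t)).comp
        (Bimodule.tensorMap u.toLin v.toLin u.map_right v.map_left) :=
      Bimodule.tensor_ext fun x y =>
        congrArg (fun w => (Bimodule.tmul (u.toLin x) w : X'.TensorCarrier Y')) (v.map_right t y)
    exact LinearMap.congr_fun h z

/-- The identity morphism of a bimodule. -/
def Bimodule.Hom.id (X : Bimodule.{uk, ur, us, ux} k R S) : Bimodule.Hom X X where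
  toLin := LinearMap.id
  map_left _ _ := rfl
  map_right _ _ := rfl

end Balanced

end Bimodules

/-! ### Triples, symmetric bimodules, Morita equivalence of triples -/

/-- The structure of a triple `(A, B, ε)`: a morphism `ε : B → A` of `k`-algebras from a commutative
algebra `B` to an associative algebra `A`, with image in the center of `A`. -/
structure Triple (k : Type uk) (A : Type uA) (B : Type uB) [CommRing k] [Ring A] [CommRing B]
    [Algebra k A] [Algebra k B] where
  /-- the structure morphism -/
  ε : B →ₐ[k] A
  central : ∀ (β : B) (a : A), ε β * a = a * ε β

section Triples

variable {k : Type uk} {A : Type uA} {B : Type uB} {A' : Type uA'} {B' : Type uB'}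
  [CommRing k] [Ring A] [CommRing B] [Algebra k A] [Algebra k B]
  [Ring A'] [CommRing B'] [Algebra k A'] [Algebra k B']

/-- An `A`-bimodule that is `B`-symmetric: `m ε(β) = ε(β) m`. -/
structure SymBimodule (t : Triple k A B) extends Bimodule.{uk, uA, uA, uM} k A A where
  symm : ∀ (β : B) (m : carrier), MulOpposite.op (t.ε β) • m = t.ε β • m

set_option linter.checkUnivs false in
/-- A Morita equivalence `(P, Q, η)` of triples between `(A, B, ε)` and `(A', B', ε')`. -/
structure MoritaEquivalence (t : Triple k A B) (t' : Triple k A' B') where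
  /-- the `A`-`A'`-bimodule `P` -/
  P : Bimodule.{uk, uA, uA', uP} k A A'
  /-- the `A'`-`A`-bimodule `Q` -/
  Q : Bimodule.{uk, uA', uA, uQ} k A' A
  /-- `P ⊗_{A'} Q` is isomorphic to `A` as an `A`-bimodule -/
  f : Bimodule.Iso (P.tensor Q) (Bimodule.regular k A)
  /-- `Q ⊗_A P` is isomorphic to `A'` as an `A'`-bimodule -/
  g : Bimodule.Iso (Q.tensor P) (Bimodule.regular k A')
  /-- the isomorphism of `k`-algebras between `B` and `B'` -/
  η : B ≃ₐ[k] B'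
  symm_P : ∀ (β : B) (p : P.carrier), t.ε β • p = MulOpposite.op (t'.ε (η β)) • p
  symm_Q : ∀ (β : B) (q : Q.carrier), MulOpposite.op (t.ε β) • q = t'.ε (η β) • q

/-- The `B'`-symmetric `A'`-bimodule `Q ⊗_A M ⊗_A P`. -/
def MoritaEquivalence.conj {t : Triple k A B} {t' : Triple k A' B'}
    (E : MoritaEquivalence.{uk, uA, uB, uA', uB', uP, uQ} t t') (M : SymBimodule.{uk, uA, uB, uM} t) :
    SymBimodule.{uk, uA', uB', max uP uQ uM} t' where
  toBimodule := (E.Q.tensor M.toBimodule).tensor E.P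
  symm β' z := by
    obtain ⟨β, rfl⟩ := E.η.surjective β'
    have h : Bimodule.rightEnd (E.Q.tensor M.toBimodule) E.P (MulOpposite.op (t'.ε (E.η β))) =
        Bimodule.leftEnd (E.Q.tensor M.toBimodule) E.P (t'.ε (E.η β)) := by
      refine Bimodule.tensor_ext fun y p => ?_
      have h₂ : Bimodule.rightEnd E.Q M.toBimodule (MulOpposite.op (t.ε β)) =
          Bimodule.leftEnd E.Q M.toBimodule (t'.ε (E.η β)) := by
        refine Bimodule.tensor_ext fun q m => ?_
        change Bimodule.tmul q (MulOpposite.op (t.ε β) • m) = Bimodule.tmul (t'.ε (E.η β) • q) m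
        rw [M.symm, ← E.symm_Q, Bimodule.smul_tmul]
      change Bimodule.tmul y (MulOpposite.op (t'.ε (E.η β)) • p) =
        Bimodule.tmul (t'.ε (E.η β) • y) p
      rw [← E.symm_P, ← Bimodule.smul_tmul]
      exact congrArg (fun w => Bimodule.tmul w p) (LinearMap.congr_fun h₂ y)
    exact LinearMap.congr_fun h z

/-- The morphism `Q ⊗_A M ⊗_A P → Q ⊗_A N ⊗_A P` induced by a bimodule morphism `M → N`. -/
def MoritaEquivalence.conjMap {t : Triple k A B} {t' : Triple k A' B'}
    (E : MoritaEquivalence.{uk, uA, uB, uA', uB', uP, uQ} t t')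
    {M : SymBimodule.{uk, uA, uB, uM} t} {N : SymBimodule.{uk, uA, uB, uN} t}
    (u : Bimodule.Hom M.toBimodule N.toBimodule) :
    Bimodule.Hom (E.conj M).toBimodule (E.conj N).toBimodule :=
  ((Bimodule.Hom.id E.Q).tensor u).tensor (Bimodule.Hom.id E.P)

end Triples

/-! ### The secondary Hochschild complex -/

/-- The positions `(i, j)` with `i < j` above the diagonal of an `n × n` matrix. -/
abbrev Pairs (n : ℕ) : Type := {p : Fin n × Fin n // p.1 < p.2}

section Complex

open Finset

variable {k : Type uk} {A : Type uA} {B : Type uB} [CommRing k] [Ring A] [CommRing B]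
  [Algebra k A] [Algebra k B]

/-- The chains `C_n((A, B, ε); M) = M ⊗ A^{⊗ n} ⊗ B^{⊗ n(n-1)/2}`, where the factors `B` are indexed
by the positions above the diagonal of an `n × n` matrix and the factors `A` by the diagonal. -/
abbrev Chains {t : Triple k A B} (M : SymBimodule.{uk, uA, uB, uM} t) (n : ℕ) :
    Type (max uk uA uB uM) :=
  M.carrier ⊗[k] ((⨂[k] _ : Fin n, A) ⊗[k] (⨂[k] _ : Pairs n, B))

variable {t : Triple k A B} {M : SymBimodule.{uk, uA, uB, uM} t}

/-- The elementary chain `m ⊗ (matrix with diagonal a and entries b above the diagonal)`. -/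
def elem {n : ℕ} (m : M.carrier) (a : Fin n → A) (b : Pairs n → B) : Chains M n :=
  m ⊗ₜ[k] (PiTensorProduct.tprod k a ⊗ₜ[k] PiTensorProduct.tprod k b)

/-- Linear maps that agree on the elementary chains are equal. -/
theorem chains_ext {n : ℕ} {X : Type*} [AddCommGroup X] [Module k X] {F G : Chains M n →ₗ[k] X}
    (h : ∀ m a b, F (elem m a b) = G (elem m a b)) : F = G := by
  ext m a b
  exact h m a b

/-- The linear map on chains given on elementary chains by a function that is linear in `m` and
multilinear in the entries of the matrix. -/
def liftChains {n : ℕ} {X : Type*} [AddCommGroup X] [Module k X]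
    (F : M.carrier → (Fin n → A) → (Pairs n → B) → X)
    (hM : ∀ a b, IsLinearMap k fun m => F m a b)
    (hA : ∀ m a i b, IsLinearMap k fun x => F m (Function.update a i x) b)
    (hB : ∀ m a b p, IsLinearMap k fun x => F m a (Function.update b p x)) :
    Chains M n →ₗ[k] X :=
  TensorProduct.lift <| IsLinearMap.mk'
    (fun m => TensorProduct.lift <| PiTensorProduct.lift
      { toFun := fun a => PiTensorProduct.lift
          { toFun := fun b => F m a b
            map_update_add' := fun b p x y => by
              convert (hB m a b p).map_add x y
            map_update_smul' := fun b p c x => by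
              convert (hB m a b p).map_smul c x }
        map_update_add' := fun a i x y => by
          ext b
          simpa using (by convert (hA m a i b).map_add x y)
        map_update_smul' := fun a i c x => by
          ext b
          simpa using (by convert (hA m a i b).map_smul c x) })
    ⟨fun m m' => by ext a b; simpa using (hM a b).map_add m m',
      fun c m => by ext a b; simpa using (hM a b).map_smul c m⟩

theorem liftChains_elem {n : ℕ} {X : Type*} [AddCommGroup X] [Module k X]
    (F : M.carrier → (Fin n → A) → (Pairs n → B) → X)
    (hM : ∀ a b, IsLinearMap k fun m => F m a b)
    (hA : ∀ m a i b, IsLinearMap k fun x => F m (Function.update a i x) b)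
    (hB : ∀ m a b p, IsLinearMap k fun x => F m a (Function.update b p x))
    (m : M.carrier) (a : Fin n → A) (b : Pairs n → B) :
    liftChains F hM hA hB (elem m a b) = F m a b := by
  simp [liftChains, elem]

theorem elem_linear_left {V : Type*} [AddCommGroup V] [Module k V] {n : ℕ} {L : V → M.carrier}
    (hL : IsLinearMap k L) (a : Fin n → A) (b : Pairs n → B) :
    IsLinearMap k fun x => (elem (L x) a b : Chains M n) :=
  ⟨fun x y => by simp only [elem, hL.map_add, TensorProduct.add_tmul],
    fun c x => by simp only [elem, hL.map_smul, TensorProduct.smul_tmul']⟩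

theorem elem_linear_diag {V : Type*} [AddCommGroup V] [Module k V] {n : ℕ} {L : V → A}
    (hL : IsLinearMap k L) (m : M.carrier) (a : Fin n → A) (i : Fin n) (b : Pairs n → B) :
    IsLinearMap k fun x => (elem m (Function.update a i (L x)) b : Chains M n) :=
  ⟨fun x y => by simp only [elem, hL.map_add, MultilinearMap.map_update_add,
      TensorProduct.add_tmul, TensorProduct.tmul_add],
    fun c x => by simp only [elem, hL.map_smul, MultilinearMap.map_update_smul,
      ← TensorProduct.smul_tmul', TensorProduct.tmul_smul]⟩

theorem elem_linear_off {V : Type*} [AddCommGroup V] [Module k V] {n : ℕ} {L : V → B}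
    (hL : IsLinearMap k L) (m : M.carrier) (a : Fin n → A) (b : Pairs n → B) (p : Pairs n) :
    IsLinearMap k fun x => (elem m a (Function.update b p (L x)) : Chains M n) :=
  ⟨fun x y => by simp only [elem, hL.map_add, MultilinearMap.map_update_add,
      TensorProduct.tmul_add],
    fun c x => by simp only [elem, hL.map_smul, MultilinearMap.map_update_smul,
      TensorProduct.tmul_smul]⟩

/-- Shift of a position by one row and one column. -/
def Pairs.succ {n : ℕ} (p : Pairs n) : Pairs (n + 1) :=
  ⟨(p.1.1.succ, p.1.2.succ), Fin.succ_lt_succ_iff.2 p.2⟩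

/-- A position of an `n × n` matrix as a position of an `(n + 1) × (n + 1)` matrix. -/
def Pairs.castSucc {n : ℕ} (p : Pairs n) : Pairs (n + 1) :=
  ⟨(p.1.1.castSucc, p.1.2.castSucc), p.2⟩

/-- The position right above the diagonal in row `c`. -/
def Pairs.adj {n : ℕ} (c : Fin n) : Pairs (n + 1) :=
  ⟨(c.castSucc, c.succ), Fin.castSucc_lt_succ⟩

/-- The coefficient `m a₁ ε(b₁₂ b₁₃ ⋯ b₁ₙ)`. -/
def firstCoeff {n : ℕ} (m : M.carrier) (a : Fin (n + 1) → A) (b : Pairs (n + 1) → B) : M.carrier :=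
  MulOpposite.op (a 0 * t.ε (∏ p : Pairs (n + 1) with p.1.1 = 0, b p)) • m

/-- The coefficient `aₙ ε(bₙ₋₁ₙ ⋯ b₂ₙ b₁ₙ) m`. -/
def lastCoeff {n : ℕ} (m : M.carrier) (a : Fin (n + 1) → A) (b : Pairs (n + 1) → B) : M.carrier :=
  (a (Fin.last n) * t.ε (∏ p : Pairs (n + 1) with p.1.2 = Fin.last n, b p)) • m

/-- The diagonal after rows and columns `c`, `c + 1` are merged: the entries `a_c` and `a_{c+1}` are
replaced by `a_c ε(b_{c,c+1}) a_{c+1}`. -/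
def mergeDiag (t : Triple k A B) {n : ℕ} (c : Fin n) (a : Fin (n + 1) → A) (b : Pairs (n + 1) → B) :
    Fin n → A := fun j =>
  if j < c then a j.castSucc
  else if j = c then a c.castSucc * t.ε (b (Pairs.adj c)) * a c.succ
  else a j.succ

/-- The entries above the diagonal after rows and columns `c`, `c + 1` are merged: `c.predAbove`
sends `c` and `c + 1` to `c` and is otherwise injective and increasing, and entries that come to the
same position are multiplied. -/
def mergeOff {n : ℕ} (c : Fin n) (b : Pairs (n + 1) → B) : Pairs n → B := fun q =>
  ∏ p : Pairs (n + 1) with (c.predAbove p.1.1, c.predAbove p.1.2) = q.1, b p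

theorem Pairs.succ_injective {n : ℕ} : Function.Injective (Pairs.succ (n := n)) := by
  rintro ⟨⟨i, j⟩, h⟩ ⟨⟨i', j'⟩, h'⟩ e
  simpa [Pairs.succ] using e

theorem Pairs.castSucc_injective {n : ℕ} : Function.Injective (Pairs.castSucc (n := n)) := by
  rintro ⟨⟨i, j⟩, h⟩ ⟨⟨i', j'⟩, h'⟩ e
  simpa [Pairs.castSucc] using e

theorem Pairs.exists_succ {n : ℕ} (p : Pairs (n + 1)) (h : p.1.1 ≠ 0) :
    ∃ q : Pairs n, q.succ = p := by
  obtain ⟨⟨i, j⟩, hij⟩ := p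
  obtain ⟨i, rfl⟩ := Fin.exists_succ_eq.2 h
  obtain ⟨j, rfl⟩ := Fin.exists_succ_eq.2 (Fin.ne_zero_of_lt hij)
  exact ⟨⟨(i, j), Fin.succ_lt_succ_iff.1 hij⟩, rfl⟩

theorem Pairs.exists_castSucc {n : ℕ} (p : Pairs (n + 1)) (h : p.1.2 ≠ Fin.last n) :
    ∃ q : Pairs n, q.castSucc = p := by
  obtain ⟨⟨i, j⟩, hij⟩ := p
  obtain ⟨j, rfl⟩ := Fin.exists_castSucc_eq.2 h
  obtain ⟨i, rfl⟩ := Fin.exists_castSucc_eq.2 (Fin.ne_last_of_lt hij)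
  exact ⟨⟨(i, j), hij⟩, rfl⟩

theorem isLinearMap_prod_update {ι : Type*} [DecidableEq ι] (s : Finset ι) (b : ι → B) {p : ι}
    (hp : p ∈ s) : IsLinearMap k fun x => ∏ q ∈ s, Function.update b p x q := by
  simp only [Finset.prod_update_of_mem hp]
  exact ⟨fun x y => add_mul _ _ _, fun c x => smul_mul_assoc _ _ _⟩

theorem prod_update_notMem {ι : Type*} [DecidableEq ι] (s : Finset ι) (b : ι → B) {p : ι}
    (hp : p ∉ s) (x : B) : ∏ q ∈ s, Function.update b p x q = ∏ q ∈ s, b q :=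
  Finset.prod_congr rfl fun q hq => Function.update_of_ne (by rintro rfl; exact hp hq) _ _

theorem isLinearMap_firstCoeff_off {n : ℕ} (m : M.carrier) (a : Fin (n + 1) → A)
    (b : Pairs (n + 1) → B) (p : Pairs (n + 1)) (hp : p.1.1 = 0) :
    IsLinearMap k fun x => firstCoeff m a (Function.update b p x) := by
  have h := isLinearMap_prod_update (k := k) (univ.filter fun p : Pairs (n + 1) => p.1.1 = 0) b
    (p := p) (by simpa using hp)
  constructor
  · intro x y
    simp only [firstCoeff, h.map_add, map_add, mul_add, MulOpposite.op_add, add_smul]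
  · intro c x
    simp only [firstCoeff, h.map_smul, map_smul, mul_smul_comm, MulOpposite.op_smul, smul_assoc]

theorem isLinearMap_lastCoeff_off {n : ℕ} (m : M.carrier) (a : Fin (n + 1) → A)
    (b : Pairs (n + 1) → B) (p : Pairs (n + 1)) (hp : p.1.2 = Fin.last n) :
    IsLinearMap k fun x => lastCoeff m a (Function.update b p x) := by
  have h := isLinearMap_prod_update (k := k)
    (univ.filter fun p : Pairs (n + 1) => p.1.2 = Fin.last n) b (p := p) (by simpa using hp)
  constructor
  · intro x y
    simp only [lastCoeff, h.map_add, map_add, mul_add, add_smul]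
  · intro c x
    simp only [lastCoeff, h.map_smul, map_smul, mul_smul_comm, smul_assoc]

theorem predAbove_val {n : ℕ} (c : Fin n) (i : Fin (n + 1)) :
    (c.predAbove i).val = if i.val ≤ c.val then i.val else i.val - 1 := by
  by_cases h : i.val ≤ c.val
  · rw [if_pos h, Fin.predAbove_of_le_castSucc c i h, Fin.coe_castPred]
  · rw [if_neg h, Fin.predAbove_of_castSucc_lt c i (not_le.1 h), Fin.val_pred]

theorem predAbove_lt {n : ℕ} (c : Fin n) (p : Pairs (n + 1)) (hp : p ≠ Pairs.adj c) :
    c.predAbove p.1.1 < c.predAbove p.1.2 := by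
  obtain ⟨⟨i, j⟩, hij⟩ := p
  have h₁ : i.val < j.val := hij
  have h₂ : ¬ (i.val = c.val ∧ j.val = c.val + 1) := fun h =>
    hp (Subtype.ext (Prod.ext (Fin.ext h.1) (Fin.ext h.2)))
  rw [Fin.lt_def, predAbove_val, predAbove_val]
  dsimp only
  split_ifs <;> omega

theorem isLinearMap_mergeOff {n : ℕ} (c : Fin n) (m : M.carrier) (a : Fin n → A)
    (b : Pairs (n + 1) → B) (p : Pairs (n + 1)) (hp : p ≠ Pairs.adj c) :
    IsLinearMap k fun x => (elem m a (mergeOff c (Function.update b p x)) : Chains M n) := by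
  let q : Pairs n := ⟨(c.predAbove p.1.1, c.predAbove p.1.2), predAbove_lt c p hp⟩
  have h := isLinearMap_prod_update (k := k)
    (univ.filter fun p : Pairs (n + 1) => (c.predAbove p.1.1, c.predAbove p.1.2) = q.1) b (p := p)
    (by simp [q])
  have e : ∀ x, mergeOff c (Function.update b p x) = Function.update (mergeOff c b) q
      (∏ r : Pairs (n + 1) with (c.predAbove r.1.1, c.predAbove r.1.2) = q.1,
        Function.update b p x r) := by
    intro x
    funext r
    by_cases hr : r = q
    · subst hr
      simp [mergeOff]
    · rw [Function.update_of_ne hr, mergeOff, mergeOff, prod_update_notMem]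
      simp only [mem_filter, mem_univ, true_and]
      exact fun e => hr (Subtype.ext e.symm)
  simp only [e]
  exact elem_linear_off h m a (mergeOff c b) q

theorem mergeOff_update_adj {n : ℕ} (c : Fin n) (b : Pairs (n + 1) → B) (x : B) :
    mergeOff c (Function.update b (Pairs.adj c) x) = mergeOff c b := by
  funext q
  rw [mergeOff, mergeOff, prod_update_notMem]
  simp only [mem_filter, mem_univ, true_and, Pairs.adj]
  intro e
  have h₁ := congrArg (fun z => z.1.val) e
  have h₂ := congrArg (fun z => z.2.val) e
  have h₃ : q.1.1.val < q.1.2.val := q.2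
  simp only [predAbove_val, Fin.val_castSucc, Fin.val_succ] at h₁ h₂
  split_ifs at h₁ h₂ <;> omega

theorem isLinearMap_id' (V : Type*) [AddCommGroup V] [Module k V] :
    IsLinearMap k (fun x : V => x) :=
  ⟨fun _ _ => rfl, fun _ _ => rfl⟩

theorem isLinearMap_mergeDiag {n : ℕ} (c : Fin n) (m : M.carrier) (a : Fin (n + 1) → A)
    (b : Pairs (n + 1) → B) (b' : Pairs n → B) (i : Fin (n + 1)) :
    IsLinearMap k fun x =>
      (elem m (mergeDiag t c (Function.update a i x) b) b' : Chains M n) := by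
  -- the only entry of the new diagonal that depends on entry `i` of the old one is `predAbove i`
  let L : A → A := fun x =>
    if i = c.castSucc then x * t.ε (b (Pairs.adj c)) * a c.succ
    else if i = c.succ then a c.castSucc * t.ε (b (Pairs.adj c)) * x else x
  have hL : IsLinearMap k L := by
    constructor
    · intro x y
      simp only [L]
      split_ifs <;> simp only [add_mul, mul_add]
    · intro r x
      simp only [L]
      split_ifs <;> simp only [smul_mul_assoc, mul_smul_comm]
  have e : ∀ x, mergeDiag t c (Function.update a i x) b =
      Function.update (mergeDiag t c a b) (c.predAbove i) (L x) := by
    intro x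
    funext j
    have hv := predAbove_val c i
    have hi := i.isLt
    simp only [mergeDiag, Function.update_apply, L, Fin.ext_iff, Fin.lt_def, Fin.val_castSucc,
      Fin.val_succ]
    by_cases h : i.val ≤ c.val
    · rw [if_pos h] at hv
      split_ifs <;> first | rfl | omega
    · rw [if_neg h] at hv
      split_ifs <;> first | rfl | omega
  simp only [e]
  exact elem_linear_diag hL m _ _ b'

theorem isLinearMap_mergeDiag_off {n : ℕ} (c : Fin n) (m : M.carrier) (a : Fin (n + 1) → A)
    (b : Pairs (n + 1) → B) (b' : Pairs n → B) :
    IsLinearMap k fun x =>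
      (elem m (mergeDiag t c a (Function.update b (Pairs.adj c) x)) b' : Chains M n) := by
  have hL : IsLinearMap k fun x => a c.castSucc * t.ε x * a c.succ :=
    ⟨fun x y => by simp only [map_add, mul_add, add_mul],
      fun r x => by simp only [map_smul, mul_smul_comm, smul_mul_assoc]⟩
  have e : ∀ x, mergeDiag t c a (Function.update b (Pairs.adj c) x) =
      Function.update (mergeDiag t c a b) c (a c.castSucc * t.ε x * a c.succ) := by
    intro x
    funext j
    rcases lt_trichotomy j c with h | rfl | h
    · simp [mergeDiag, h, h.ne]
    · simp [mergeDiag]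
    · simp [mergeDiag, h.not_gt, h.ne']
  simp only [e]
  exact elem_linear_diag hL m _ _ b'

variable (M)

/-- The face `m ⊗ (a, b) ↦ m a₁ ε(b₁₂ ⋯ b₁ₙ) ⊗ (a, b without the first row and column)`. -/
def firstFace (n : ℕ) : Chains M (n + 1) →ₗ[k] Chains M n :=
  liftChains (fun m a b => elem (firstCoeff m a b) (fun i => a i.succ) (fun p => b p.succ))
    (fun a b => elem_linear_left
      ⟨fun _ _ => smul_add _ _ _, fun r m => smul_comm _ r m⟩ _ _)
    (fun m a i b => by
      induction i using Fin.cases with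
      | zero =>
        have hL : IsLinearMap k fun x => firstCoeff m (Function.update a 0 x) b :=
          ⟨fun x y => by
            simp only [firstCoeff, Function.update_self, add_mul, MulOpposite.op_add, add_smul],
          fun r x => by
            simp only [firstCoeff, Function.update_self, smul_mul_assoc, MulOpposite.op_smul,
              smul_assoc]⟩
        simpa using elem_linear_left hL (fun i => a i.succ) (fun p => b p.succ)
      | succ i =>
        have e : ∀ x, (fun j : Fin n => Function.update a i.succ x j.succ) =
            Function.update (fun j => a j.succ) i x := fun x => by
          funext j
          simp [Function.update_apply]
        simp only [e, firstCoeff, Function.update_of_ne (Fin.succ_ne_zero i).symm]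
        exact elem_linear_diag (isLinearMap_id' A) _ _ _ _)
    (fun m a b p => by
      by_cases hp : p.1.1 = 0
      · have e : ∀ x, (fun q : Pairs n => Function.update b p x q.succ) = fun q => b q.succ :=
          fun x => funext fun q => Function.update_of_ne
            (fun h => Fin.succ_ne_zero q.1.1 (by rw [← hp, ← h]; rfl)) _ _
        simp only [e]
        exact elem_linear_left (isLinearMap_firstCoeff_off m a b p hp) _ _
      · obtain ⟨q, rfl⟩ := p.exists_succ hp
        have e : ∀ x, (fun r : Pairs n => Function.update b q.succ x r.succ) =
            Function.update (fun r => b r.succ) q x := fun x => by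
          funext r
          simp [Function.update_apply, Pairs.succ_injective.eq_iff]
        have e' : ∀ x, firstCoeff m a (Function.update b q.succ x) = firstCoeff m a b := fun x => by
          rw [firstCoeff, firstCoeff, prod_update_notMem]
          simpa using hp
        simp only [e, e']
        exact elem_linear_off (isLinearMap_id' B) _ _ _ _)

/-- The face `m ⊗ (a, b) ↦ aₙ ε(bₙ₋₁ₙ ⋯ b₁ₙ) m ⊗ (a, b without the last row and column)`. -/
def lastFace (n : ℕ) : Chains M (n + 1) →ₗ[k] Chains M n :=
  liftChains (fun m a b => elem (lastCoeff m a b) (fun i => a i.castSucc) (fun p => b p.castSucc))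
    (fun a b => elem_linear_left
      ⟨fun _ _ => smul_add _ _ _, fun r m => smul_comm _ r m⟩ _ _)
    (fun m a i b => by
      induction i using Fin.lastCases with
      | last =>
        have hL : IsLinearMap k fun x => lastCoeff m (Function.update a (Fin.last n) x) b :=
          ⟨fun x y => by
            simp only [lastCoeff, Function.update_self, add_mul, add_smul],
          fun r x => by
            simp only [lastCoeff, Function.update_self, smul_mul_assoc, smul_assoc]⟩
        simpa [Fin.castSucc_ne_last] using
          elem_linear_left hL (fun i => a i.castSucc) (fun p => b p.castSucc)
      | cast i =>
        have e : ∀ x, (fun j : Fin n => Function.update a i.castSucc x j.castSucc) =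
            Function.update (fun j => a j.castSucc) i x := fun x => by
          funext j
          simp [Function.update_apply]
        simp only [e, lastCoeff, Function.update_of_ne (Fin.castSucc_ne_last i).symm]
        exact elem_linear_diag (isLinearMap_id' A) _ _ _ _)
    (fun m a b p => by
      by_cases hp : p.1.2 = Fin.last n
      · have e : ∀ x, (fun q : Pairs n => Function.update b p x q.castSucc) =
            fun q => b q.castSucc :=
          fun x => funext fun q => Function.update_of_ne
            (fun h => Fin.castSucc_ne_last q.1.2 (by rw [← hp, ← h]; rfl)) _ _
        simp only [e]
        exact elem_linear_left (isLinearMap_lastCoeff_off m a b p hp) _ _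
      · obtain ⟨q, rfl⟩ := p.exists_castSucc hp
        have e : ∀ x, (fun r : Pairs n => Function.update b q.castSucc x r.castSucc) =
            Function.update (fun r => b r.castSucc) q x := fun x => by
          funext r
          simp [Function.update_apply, Pairs.castSucc_injective.eq_iff]
        have e' : ∀ x, lastCoeff m a (Function.update b q.castSucc x) = lastCoeff m a b :=
          fun x => by
            rw [lastCoeff, lastCoeff, prod_update_notMem]
            simpa using hp
        simp only [e, e']
        exact elem_linear_off (isLinearMap_id' B) _ _ _ _)

/-- The face of `m ⊗ (a, b)` in which the rows and columns `c` and `c + 1` are merged. -/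
def mergeFace (n : ℕ) (c : Fin n) : Chains M (n + 1) →ₗ[k] Chains M n :=
  liftChains (fun m a b => elem m (mergeDiag t c a b) (mergeOff c b))
    (fun a b => elem_linear_left (isLinearMap_id' M.carrier) _ _)
    (fun m a i b => isLinearMap_mergeDiag c m a b _ i)
    (fun m a b p => by
      by_cases hp : p = Pairs.adj c
      · subst hp
        simp only [mergeOff_update_adj]
        exact isLinearMap_mergeDiag_off c m a b _
      · have e : ∀ x, mergeDiag t c a (Function.update b p x) = mergeDiag t c a b := fun x => by
          funext j
          simp only [mergeDiag, Function.update_of_ne (Ne.symm hp)]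
        simp only [e]
        exact isLinearMap_mergeOff c m _ b p hp)

variable {M}

theorem firstFace_elem {n : ℕ} (m : M.carrier) (a : Fin (n + 1) → A) (b : Pairs (n + 1) → B) :
    firstFace M n (elem m a b) =
      elem (firstCoeff m a b) (fun i => a i.succ) (fun p => b p.succ) :=
  liftChains_elem _ _ _ _ m a b

theorem lastFace_elem {n : ℕ} (m : M.carrier) (a : Fin (n + 1) → A) (b : Pairs (n + 1) → B) :
    lastFace M n (elem m a b) =
      elem (lastCoeff m a b) (fun i => a i.castSucc) (fun p => b p.castSucc) :=
  liftChains_elem _ _ _ _ m a b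

theorem mergeFace_elem {n : ℕ} (c : Fin n) (m : M.carrier) (a : Fin (n + 1) → A)
    (b : Pairs (n + 1) → B) :
    mergeFace M n c (elem m a b) = elem m (mergeDiag t c a b) (mergeOff c b) :=
  liftChains_elem _ _ _ _ m a b

/-! The boundary squares to zero. -/

theorem predAbove_val' {n : ℕ} (c : Fin n) (i : Fin (n + 1)) :
    (c.predAbove i).val = min i.val (max c.val (i.val - 1)) := by
  rw [predAbove_val]
  split_ifs <;> omega

theorem Pairs.val_lt {n : ℕ} (p : Pairs n) : p.1.1.val < p.1.2.val ∧ p.1.2.val < n :=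
  ⟨p.2, p.1.2.isLt⟩

theorem prod_succ {n : ℕ} (b : Pairs (n + 1) → B) (P : Pairs n → Prop) (P' : Pairs (n + 1) → Prop)
    [DecidablePred P] [DecidablePred P']
    (h : ∀ q : Pairs n, P q ↔ P' q.succ) (h' : ∀ p, P' p → p.1.1 ≠ 0) :
    ∏ q : Pairs n with P q, b q.succ = ∏ p : Pairs (n + 1) with P' p, b p := by
  refine Finset.prod_bij (fun q _ => q.succ) ?_ ?_ ?_ ?_
  · intro q hq
    simpa using (h q).1 (by simpa using hq)
  · intro q _ q' _ e
    exact Pairs.succ_injective e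
  · intro p hp
    have hp : P' p := by simpa using hp
    obtain ⟨q, rfl⟩ := p.exists_succ (h' p hp)
    exact ⟨q, by simpa using (h q).2 hp, rfl⟩
  · intro q _
    rfl

theorem prod_castSucc {n : ℕ} (b : Pairs (n + 1) → B) (P : Pairs n → Prop)
    (P' : Pairs (n + 1) → Prop) [DecidablePred P] [DecidablePred P']
    (h : ∀ q : Pairs n, P q ↔ P' q.castSucc) (h' : ∀ p, P' p → p.1.2 ≠ Fin.last n) :
    ∏ q : Pairs n with P q, b q.castSucc = ∏ p : Pairs (n + 1) with P' p, b p := by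
  refine Finset.prod_bij (fun q _ => q.castSucc) ?_ ?_ ?_ ?_
  · intro q hq
    simpa using (h q).1 (by simpa using hq)
  · intro q _ q' _ e
    exact Pairs.castSucc_injective e
  · intro p hp
    have hp : P' p := by simpa using hp
    obtain ⟨q, rfl⟩ := p.exists_castSucc (h' p hp)
    exact ⟨q, by simpa using (h q).2 hp, rfl⟩
  · intro q _
    rfl

theorem prod_mergeOff {n : ℕ} (c : Fin n) (b : Pairs (n + 1) → B) (P : Pairs n → Prop)
    (P' : Pairs (n + 1) → Prop) [DecidablePred P] [DecidablePred P']
    (h : ∀ (p : Pairs (n + 1)) (q : Pairs n),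
      (c.predAbove p.1.1, c.predAbove p.1.2) = q.1 → (P q ↔ P' p))
    (h' : ∀ p, P' p → p ≠ Pairs.adj c) :
    ∏ q : Pairs n with P q, mergeOff c b q = ∏ p : Pairs (n + 1) with P' p, b p := by
  classical
  simp only [mergeOff]
  rw [← Finset.prod_biUnion]
  · refine Finset.prod_congr ?_ fun _ _ => rfl
    ext p
    simp only [mem_biUnion, mem_filter, mem_univ, true_and]
    constructor
    · rintro ⟨q, hq, e⟩
      exact (h p q e).1 hq
    · intro hp
      exact ⟨⟨_, predAbove_lt c p (h' p hp)⟩, (h p _ rfl).2 hp, rfl⟩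
  · intro q _ q' _ hne
    refine Finset.disjoint_left.2 fun p hp hp' => hne ?_
    simp only [mem_filter, mem_univ, true_and] at hp hp'
    exact Subtype.ext (hp.symm.trans hp')

theorem prod_filter_single {n : ℕ} (b : Pairs n → B) (P : Pairs n → Prop) [DecidablePred P]
    (p : Pairs n) (h : ∀ q, P q ↔ q = p) : ∏ q : Pairs n with P q, b q = b p := by
  have : (univ.filter P) = {p} := by
    ext q
    simp [h]
  rw [this, Finset.prod_singleton]

theorem prod_filter_mul {n : ℕ} (b : Pairs n → B) (P P₁ P₂ : Pairs n → Prop) [DecidablePred P]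
    [DecidablePred P₁] [DecidablePred P₂] (h : ∀ q, P q ↔ P₁ q ∨ P₂ q)
    (hd : ∀ q, P₁ q → ¬ P₂ q) :
    ∏ q : Pairs n with P q, b q =
      (∏ q : Pairs n with P₁ q, b q) * ∏ q : Pairs n with P₂ q, b q := by
  classical
  rw [← Finset.prod_union]
  · refine Finset.prod_congr ?_ fun _ _ => rfl
    ext q
    simp [h]
  · refine Finset.disjoint_left.2 fun q hq hq' => ?_
    simp only [mem_filter, mem_univ, true_and] at hq hq'
    exact hd q hq hq'

theorem first_merge_zero (n : ℕ) :
    (firstFace M n).comp (mergeFace M (n + 1) 0) = (firstFace M n).comp (firstFace M (n + 1)) := by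
  refine chains_ext fun m a b => ?_
  simp only [LinearMap.comp_apply, mergeFace_elem, firstFace_elem]
  have hoff : ∀ p : Pairs n, mergeOff 0 b p.succ = b p.succ.succ := fun p =>
    prod_filter_single _ _ _ fun q => by
      have := q.val_lt
      have := p.val_lt
      simp only [Subtype.ext_iff, Prod.ext_iff, Fin.ext_iff, predAbove_val', Pairs.succ,
        Fin.val_succ, Fin.val_zero]
      omega
  have hdiag : ∀ i : Fin n, mergeDiag t 0 a b i.succ = a i.succ.succ := fun i => by
    simp [mergeDiag]
  have hX : ∏ q : Pairs (n + 1) with q.1.1 = 0, mergeOff 0 b q =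
      ∏ p : Pairs (n + 2) with p.1.1.val ≤ 1 ∧ p.1.2.val ≠ 1, b p :=
    prod_mergeOff _ _ _ _ (fun p q e => by
      have := q.val_lt
      have := p.val_lt
      simp only [Prod.ext_iff, Fin.ext_iff, predAbove_val', Fin.val_zero] at e ⊢
      omega) (fun p hp e => by
      subst e
      exact hp.2 rfl)
  have hZ : ∏ q : Pairs (n + 1) with q.1.1 = 0, b q.succ =
      ∏ p : Pairs (n + 2) with p.1.1.val = 1, b p :=
    prod_succ _ _ _ (fun q => by
      simp only [Pairs.succ, Fin.ext_iff, Fin.val_succ, Fin.val_zero]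
      omega) (fun p hp h => by
      have := congrArg Fin.val h
      simp only [Fin.val_zero] at this
      omega)
  have hY : ∏ p : Pairs (n + 2) with p.1.1 = 0, b p = b (Pairs.adj 0) *
      ∏ p : Pairs (n + 2) with p.1.1.val = 0 ∧ p.1.2.val ≠ 1, b p := by
    rw [prod_filter_mul b _ (fun p => p = Pairs.adj 0) (fun p => p.1.1.val = 0 ∧ p.1.2.val ≠ 1),
      prod_filter_single b _ _ fun q => Iff.rfl]
    all_goals
      intro q
      have := q.val_lt
      simp only [Subtype.ext_iff, Prod.ext_iff, Fin.ext_iff, Pairs.adj, Fin.val_zero,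
        Fin.val_castSucc, Fin.val_succ]
      omega
  have hX' : ∏ p : Pairs (n + 2) with p.1.1.val ≤ 1 ∧ p.1.2.val ≠ 1, b p =
      (∏ p : Pairs (n + 2) with p.1.1.val = 0 ∧ p.1.2.val ≠ 1, b p) *
        ∏ p : Pairs (n + 2) with p.1.1.val = 1, b p :=
    prod_filter_mul b _ _ _ (fun q => by have := q.val_lt; omega) (fun q => by omega)
  have hcoeff : firstCoeff m (mergeDiag t 0 a b) (mergeOff 0 b) =
      firstCoeff (firstCoeff m a b) (fun i => a i.succ) (fun p => b p.succ) := by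
    simp only [firstCoeff, hX, hX', hY, hZ, mergeDiag, smul_smul, ← MulOpposite.op_mul, map_mul]
    congr 2
    simp only [lt_self_iff_false, if_false, if_true, Fin.castSucc_zero, mul_assoc]
    congr 2
    rw [← mul_assoc, ← mul_assoc, t.central _ (a (Fin.succ 0))]
  rw [hcoeff]
  simp only [hoff, hdiag]

theorem last_merge_last (n : ℕ) :
    (lastFace M n).comp (mergeFace M (n + 1) (Fin.last n)) =
      (lastFace M n).comp (lastFace M (n + 1)) := by
  refine chains_ext fun m a b => ?_
  simp only [LinearMap.comp_apply, mergeFace_elem, lastFace_elem]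
  have hoff : ∀ p : Pairs n, mergeOff (Fin.last n) b p.castSucc = b p.castSucc.castSucc := fun p =>
    prod_filter_single _ _ _ fun q => by
      have := q.val_lt
      have := p.val_lt
      simp only [Subtype.ext_iff, Prod.ext_iff, Fin.ext_iff, predAbove_val', Pairs.castSucc,
        Fin.val_castSucc, Fin.val_last]
      omega
  have hdiag : ∀ i : Fin n, mergeDiag t (Fin.last n) a b i.castSucc = a i.castSucc.castSucc :=
    fun i => by simp [mergeDiag, Fin.castSucc_lt_last]
  have hX : ∏ q : Pairs (n + 1) with q.1.2 = Fin.last n, mergeOff (Fin.last n) b q =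
      ∏ p : Pairs (n + 2) with n ≤ p.1.2.val ∧ p.1.1.val ≠ n, b p :=
    prod_mergeOff _ _ _ _ (fun p q e => by
      have := q.val_lt
      have := p.val_lt
      simp only [Prod.ext_iff, Fin.ext_iff, predAbove_val', Fin.val_last] at e ⊢
      omega) (fun p hp e => by
      subst e
      exact hp.2 rfl)
  have hZ : ∏ q : Pairs (n + 1) with q.1.2 = Fin.last n, b q.castSucc =
      ∏ p : Pairs (n + 2) with p.1.2.val = n, b p :=
    prod_castSucc _ _ _ (fun q => by simp [Pairs.castSucc, Fin.ext_iff]) (fun p hp h => by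
      have := congrArg Fin.val h
      simp only [Fin.val_last] at this
      omega)
  have hY : ∏ p : Pairs (n + 2) with p.1.2 = Fin.last (n + 1), b p = b (Pairs.adj (Fin.last n)) *
      ∏ p : Pairs (n + 2) with p.1.2.val = n + 1 ∧ p.1.1.val ≠ n, b p := by
    rw [prod_filter_mul b _ (fun p => p = Pairs.adj (Fin.last n))
      (fun p => p.1.2.val = n + 1 ∧ p.1.1.val ≠ n), prod_filter_single b _ _ fun q => Iff.rfl]
    all_goals
      intro q
      have := q.val_lt
      simp only [Subtype.ext_iff, Prod.ext_iff, Fin.ext_iff, Pairs.adj, Fin.val_last,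
        Fin.val_castSucc, Fin.val_succ]
      omega
  have hX' : ∏ p : Pairs (n + 2) with n ≤ p.1.2.val ∧ p.1.1.val ≠ n, b p =
      (∏ p : Pairs (n + 2) with p.1.2.val = n, b p) *
        ∏ p : Pairs (n + 2) with p.1.2.val = n + 1 ∧ p.1.1.val ≠ n, b p :=
    prod_filter_mul b _ _ _ (fun q => by have := q.val_lt; omega) (fun q => by omega)
  have hcoeff : lastCoeff m (mergeDiag t (Fin.last n) a b) (mergeOff (Fin.last n) b) =
      lastCoeff (lastCoeff m a b) (fun i => a i.castSucc) (fun p => b p.castSucc) := by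
    simp only [lastCoeff, hX, hX', hY, hZ, mergeDiag, smul_smul, map_mul]
    congr 1
    simp only [lt_self_iff_false, if_false, if_true, Fin.succ_last, mul_assoc]
    congr 1
    simp only [t.central _ (a (Fin.last (n + 1)) * _), mul_assoc, ← map_mul]
    congr 2
    ring
  rw [hcoeff]
  simp only [hoff, hdiag]

theorem first_merge_succ (n : ℕ) (c : Fin n) :
    (firstFace M n).comp (mergeFace M (n + 1) c.succ) =
      (mergeFace M n c).comp (firstFace M (n + 1)) := by
  refine chains_ext fun m a b => ?_
  simp only [LinearMap.comp_apply, mergeFace_elem, firstFace_elem]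
  have hoff : (fun q : Pairs n => mergeOff c.succ b q.succ) = mergeOff c fun q => b q.succ := by
    funext q
    refine (prod_succ _ _ _ (fun p => ?_) (fun p hp h => ?_)).symm
    · have := q.val_lt
      have := p.val_lt
      simp only [Prod.ext_iff, Fin.ext_iff, predAbove_val', Pairs.succ, Fin.val_succ]
      omega
    · have h' := congrArg Fin.val h
      have := q.val_lt
      simp only [Prod.ext_iff, Fin.ext_iff, predAbove_val', Pairs.succ, Fin.val_succ,
        Fin.val_zero] at hp h'
      omega
  have hdiag : (fun i : Fin n => mergeDiag t c.succ a b i.succ) =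
      mergeDiag t c (fun i => a i.succ) fun q => b q.succ := by
    funext i
    simp only [mergeDiag, Fin.succ_lt_succ_iff, Fin.succ_inj, ← Fin.succ_castSucc]
    rfl
  have hcoeff : firstCoeff m (mergeDiag t c.succ a b) (mergeOff c.succ b) = firstCoeff m a b := by
    have h : ∏ q : Pairs (n + 1) with q.1.1 = 0, mergeOff c.succ b q =
        ∏ p : Pairs (n + 2) with p.1.1 = 0, b p :=
      prod_mergeOff _ _ _ _ (fun p q e => by
        have := q.val_lt
        have := p.val_lt
        simp only [Prod.ext_iff, Fin.ext_iff, predAbove_val', Fin.val_zero, Fin.val_succ] at e ⊢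
        omega) (fun p hp e => by
        subst e
        have := congrArg Fin.val hp
        simp [Pairs.adj] at this)
    rw [firstCoeff, firstCoeff, h]
    simp [mergeDiag]
  rw [hcoeff, hoff, hdiag]

theorem last_merge_castSucc (n : ℕ) (c : Fin n) :
    (mergeFace M n c).comp (lastFace M (n + 1)) =
      (lastFace M n).comp (mergeFace M (n + 1) c.castSucc) := by
  refine chains_ext fun m a b => ?_
  simp only [LinearMap.comp_apply, mergeFace_elem, lastFace_elem]
  have hoff : (fun q : Pairs n => mergeOff c.castSucc b q.castSucc) =
      mergeOff c fun q => b q.castSucc := by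
    funext q
    refine (prod_castSucc _ _ _ (fun p => ?_) (fun p hp h => ?_)).symm
    · have := q.val_lt
      have := p.val_lt
      simp only [Prod.ext_iff, Fin.ext_iff, predAbove_val', Pairs.castSucc, Fin.val_castSucc]
    · have h' := congrArg Fin.val h
      have := q.val_lt
      have := c.isLt
      simp only [Prod.ext_iff, Fin.ext_iff, predAbove_val', Pairs.castSucc, Fin.val_castSucc,
        Fin.val_last] at hp h'
      omega
  have hdiag : (fun i : Fin n => mergeDiag t c.castSucc a b i.castSucc) =
      mergeDiag t c (fun i => a i.castSucc) fun q => b q.castSucc := by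
    funext i
    simp only [mergeDiag, Fin.castSucc_lt_castSucc_iff, Fin.castSucc_inj, Fin.succ_castSucc]
    rfl
  have hcoeff : lastCoeff m (mergeDiag t c.castSucc a b) (mergeOff c.castSucc b) =
      lastCoeff m a b := by
    have h : ∏ q : Pairs (n + 1) with q.1.2 = Fin.last n, mergeOff c.castSucc b q =
        ∏ p : Pairs (n + 2) with p.1.2 = Fin.last (n + 1), b p :=
      prod_mergeOff _ _ _ _ (fun p q e => by
        have := q.val_lt
        have := p.val_lt
        have := c.isLt
        simp only [Prod.ext_iff, Fin.ext_iff, predAbove_val', Fin.val_last, Fin.val_castSucc]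
          at e ⊢
        omega) (fun p hp e => by
        subst e
        have h' := congrArg Fin.val hp
        have := c.isLt
        simp only [Pairs.adj, Fin.val_succ, Fin.val_castSucc, Fin.val_last] at h'
        omega)
    rw [lastCoeff, lastCoeff, h]
    simp [mergeDiag, (Fin.castSucc_lt_last c).not_gt, (Fin.castSucc_lt_last c).ne']
  rw [hcoeff, hoff, hdiag]

theorem first_last (n : ℕ) :
    (firstFace M n).comp (lastFace M (n + 1)) = (lastFace M n).comp (firstFace M (n + 1)) := by
  refine chains_ext fun m a b => ?_
  simp only [LinearMap.comp_apply, lastFace_elem, firstFace_elem]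
  let w : Pairs (n + 2) := ⟨(0, Fin.last (n + 1)), Fin.last_pos⟩
  have hY : ∏ q : Pairs (n + 1) with q.1.1 = 0, b q.castSucc =
      ∏ p : Pairs (n + 2) with p.1.1.val = 0 ∧ p.1.2.val ≠ n + 1, b p :=
    prod_castSucc _ _ _ (fun q => by
      have := q.val_lt
      simp only [Pairs.castSucc, Fin.ext_iff, Fin.val_castSucc, Fin.val_zero]
      omega) (fun p hp h => by
      have := congrArg Fin.val h
      simp only [Fin.val_last] at this
      omega)
  have hZ : ∏ q : Pairs (n + 1) with q.1.2 = Fin.last n, b q.succ =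
      ∏ p : Pairs (n + 2) with p.1.2.val = n + 1 ∧ p.1.1.val ≠ 0, b p :=
    prod_succ _ _ _ (fun q => by
      have := q.val_lt
      simp only [Pairs.succ, Fin.ext_iff, Fin.val_succ, Fin.val_last]
      omega) (fun p hp h => by
      have := congrArg Fin.val h
      simp only [Fin.val_zero] at this
      omega)
  have hY' : ∏ p : Pairs (n + 2) with p.1.1 = 0, b p = b w *
      ∏ p : Pairs (n + 2) with p.1.1.val = 0 ∧ p.1.2.val ≠ n + 1, b p := by
    rw [prod_filter_mul b _ (fun p => p = w) (fun p => p.1.1.val = 0 ∧ p.1.2.val ≠ n + 1),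
      prod_filter_single b _ _ fun q => Iff.rfl]
    all_goals
      intro q
      have := q.val_lt
      simp only [Subtype.ext_iff, Prod.ext_iff, Fin.ext_iff, w, Fin.val_zero, Fin.val_last]
      omega
  have hZ' : ∏ p : Pairs (n + 2) with p.1.2 = Fin.last (n + 1), b p = b w *
      ∏ p : Pairs (n + 2) with p.1.2.val = n + 1 ∧ p.1.1.val ≠ 0, b p := by
    rw [prod_filter_mul b _ (fun p => p = w) (fun p => p.1.2.val = n + 1 ∧ p.1.1.val ≠ 0),
      prod_filter_single b _ _ fun q => Iff.rfl]
    all_goals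
      intro q
      have := q.val_lt
      simp only [Subtype.ext_iff, Prod.ext_iff, Fin.ext_iff, w, Fin.val_zero, Fin.val_last]
      omega
  have hcoeff : firstCoeff (lastCoeff m a b) (fun i => a i.castSucc) (fun p => b p.castSucc) =
      lastCoeff (firstCoeff m a b) (fun i => a i.succ) (fun p => b p.succ) := by
    simp only [firstCoeff, lastCoeff, hY, hZ, hY', hZ', map_mul, Fin.castSucc_zero, Fin.succ_last]
    generalize t.ε (∏ p : Pairs (n + 2) with p.1.1.val = 0 ∧ p.1.2.val ≠ n + 1, b p) = y
    generalize t.ε (∏ p : Pairs (n + 2) with p.1.2.val = n + 1 ∧ p.1.1.val ≠ 0, b p) = z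
    rw [t.central _ z, ← mul_assoc, mul_smul _ (t.ε (b w)), ← M.symm,
      ← smul_comm (a (Fin.last (n + 1)) * z), smul_smul (MulOpposite.op _) (MulOpposite.op _),
      ← MulOpposite.op_mul, t.central, mul_assoc (a 0) y, ← t.central _ y]
  rw [hcoeff]
  rfl

theorem mergeDiag_lt {n : ℕ} {c j : Fin n} (h : j < c) (a : Fin (n + 1) → A)
    (b : Pairs (n + 1) → B) : mergeDiag t c a b j = a j.castSucc := if_pos h

theorem mergeDiag_self {n : ℕ} (c : Fin n) (a : Fin (n + 1) → A) (b : Pairs (n + 1) → B) :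
    mergeDiag t c a b c = a c.castSucc * t.ε (b (Pairs.adj c)) * a c.succ := by
  simp only [mergeDiag, lt_self_iff_false, if_false, if_true]

theorem mergeDiag_gt {n : ℕ} {c j : Fin n} (h : c < j) (a : Fin (n + 1) → A)
    (b : Pairs (n + 1) → B) : mergeDiag t c a b j = a j.succ := by
  rw [mergeDiag, if_neg h.not_gt, if_neg h.ne']

theorem mergeDiag_mergeDiag {n : ℕ} (i j : Fin n) (hij : i ≤ j) (a : Fin (n + 2) → A)
    (b : Pairs (n + 2) → B) :
    mergeDiag t i (mergeDiag t j.succ a b) (mergeOff j.succ b) =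
      mergeDiag t j (mergeDiag t i.castSucc a b) (mergeOff i.castSucc b) := by
  have hs : ∀ {x y : Fin n}, x ≤ y → x.castSucc < y.succ := fun h =>
    Fin.castSucc_lt_succ_iff.2 h
  funext l
  rcases hij.lt_or_eq with h | rfl
  · have h' : i.val < j.val := h
    rcases lt_trichotomy l i with hl | rfl | hl
    · rw [mergeDiag_lt hl, mergeDiag_lt (hl.trans h), mergeDiag_lt (hs (hl.trans h).le),
        mergeDiag_lt (Fin.castSucc_lt_castSucc_iff.2 hl)]
    · have hb : mergeOff j.succ b (Pairs.adj l) = b (Pairs.adj l.castSucc) :=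
        prod_filter_single _ _ _ fun q => by
          have := q.val_lt
          simp only [Subtype.ext_iff, Prod.ext_iff, Fin.ext_iff, predAbove_val', Pairs.adj,
            Fin.val_castSucc, Fin.val_succ]
          omega
      rw [mergeDiag_self, mergeDiag_lt h, mergeDiag_self, hb, mergeDiag_lt (hs h.le),
        mergeDiag_lt (Fin.succ_lt_succ_iff.2 h), Fin.succ_castSucc]
    · rcases lt_trichotomy l j with hj | rfl | hj
      · rw [mergeDiag_gt hl, mergeDiag_lt hj, mergeDiag_lt (Fin.succ_lt_succ_iff.2 hj),
          mergeDiag_gt (Fin.castSucc_lt_castSucc_iff.2 hl), Fin.succ_castSucc]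
      · have hb : mergeOff i.castSucc b (Pairs.adj l) = b (Pairs.adj l.succ) :=
          prod_filter_single _ _ _ fun q => by
            have := q.val_lt
            simp only [Subtype.ext_iff, Prod.ext_iff, Fin.ext_iff, predAbove_val', Pairs.adj,
              Fin.val_castSucc, Fin.val_succ]
            omega
        rw [mergeDiag_gt hl, mergeDiag_self, mergeDiag_self, hb,
          mergeDiag_gt (Fin.castSucc_lt_castSucc_iff.2 hl), mergeDiag_gt (hs hl.le),
          Fin.succ_castSucc]
      · rw [mergeDiag_gt hl, mergeDiag_gt hj, mergeDiag_gt (Fin.succ_lt_succ_iff.2 hj),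
          mergeDiag_gt (hs hl.le)]
  · rcases lt_trichotomy l i with hl | rfl | hl
    · rw [mergeDiag_lt hl, mergeDiag_lt hl, mergeDiag_lt (hs hl.le),
        mergeDiag_lt (Fin.castSucc_lt_castSucc_iff.2 hl)]
    · let w : Pairs (n + 2) := ⟨(l.castSucc.castSucc, l.succ.succ),
        by simp only [Fin.lt_def, Fin.val_castSucc, Fin.val_succ]; omega⟩
      have hb₁ : mergeOff l.succ b (Pairs.adj l) = b (Pairs.adj l.castSucc) * b w := by
        rw [mergeOff, prod_filter_mul b _ (fun q => q = Pairs.adj l.castSucc) (fun q => q = w),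
          prod_filter_single b _ _ fun q => Iff.rfl, prod_filter_single b _ _ fun q => Iff.rfl]
        all_goals
          intro q
          have := q.val_lt
          simp only [Subtype.ext_iff, Prod.ext_iff, Fin.ext_iff, predAbove_val', Pairs.adj, w,
            Fin.val_castSucc, Fin.val_succ]
          omega
      have hb₂ : mergeOff l.castSucc b (Pairs.adj l) = b (Pairs.adj l.succ) * b w := by
        rw [mergeOff, prod_filter_mul b _ (fun q => q = Pairs.adj l.succ) (fun q => q = w),
          prod_filter_single b _ _ fun q => Iff.rfl, prod_filter_single b _ _ fun q => Iff.rfl]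
        all_goals
          intro q
          have := q.val_lt
          simp only [Subtype.ext_iff, Prod.ext_iff, Fin.ext_iff, predAbove_val', Pairs.adj, w,
            Fin.val_castSucc, Fin.val_succ]
          omega
      rw [mergeDiag_self, mergeDiag_self, mergeDiag_self, mergeDiag_self, hb₁, hb₂,
        mergeDiag_lt (hs le_rfl), mergeDiag_gt (hs le_rfl), map_mul, map_mul, Fin.succ_castSucc]
      simp only [mul_assoc]
      rw [← mul_assoc (t.ε (b w)), t.central (b w), mul_assoc, ← mul_assoc (t.ε (b w)),
        t.central (b w), mul_assoc]
    · rw [mergeDiag_gt hl, mergeDiag_gt hl, mergeDiag_gt (Fin.succ_lt_succ_iff.2 hl),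
        mergeDiag_gt (hs hl.le)]

theorem merge_merge (n : ℕ) (i j : Fin n) (hij : i ≤ j) :
    (mergeFace M n i).comp (mergeFace M (n + 1) j.succ) =
      (mergeFace M n j).comp (mergeFace M (n + 1) i.castSucc) := by
  refine chains_ext fun m a b => ?_
  simp only [LinearMap.comp_apply, mergeFace_elem]
  have hij' : i.val ≤ j.val := hij
  have hoff : mergeOff i (mergeOff j.succ b) = mergeOff j (mergeOff i.castSucc b) := by
    funext q
    have hq := q.val_lt
    have h₁ : mergeOff i (mergeOff j.succ b) q = ∏ p : Pairs (n + 2) with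
        i.predAbove (j.succ.predAbove p.1.1) = q.1.1 ∧
          i.predAbove (j.succ.predAbove p.1.2) = q.1.2, b p :=
      prod_mergeOff _ _ _ _ (fun p r e => by
        rw [← e, Prod.ext_iff]) (fun p hp e => by
        subst e
        simp only [Fin.ext_iff, predAbove_val', Pairs.adj, Fin.val_castSucc, Fin.val_succ] at hp
        omega)
    have h₂ : mergeOff j (mergeOff i.castSucc b) q = ∏ p : Pairs (n + 2) with
        i.predAbove (j.succ.predAbove p.1.1) = q.1.1 ∧
          i.predAbove (j.succ.predAbove p.1.2) = q.1.2, b p :=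
      prod_mergeOff _ _ _ _ (fun p r e => by
        have := p.val_lt
        rw [← e]
        simp only [Prod.ext_iff, Fin.ext_iff, predAbove_val', Fin.val_castSucc, Fin.val_succ]
        omega) (fun p hp e => by
        subst e
        simp only [Fin.ext_iff, predAbove_val', Pairs.adj, Fin.val_castSucc, Fin.val_succ] at hp
        omega)
    rw [h₁, h₂]
  rw [hoff, mergeDiag_mergeDiag i j hij]

variable (M) in
/-- The boundary `∂ : C_{n+1} → C_n` of the secondary Hochschild complex, the alternating sum of the
faces. -/
def boundary (n : ℕ) : Chains M (n + 1) →ₗ[k] Chains M n :=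
  firstFace M n + ∑ c : Fin n, (-1 : k) ^ (c.val + 1) • mergeFace M n c +
    (-1 : k) ^ (n + 1) • lastFace M n

theorem boundary_elem {n : ℕ} (m : M.carrier) (a : Fin (n + 1) → A) (b : Pairs (n + 1) → B) :
    boundary M n (elem m a b) =
      elem (firstCoeff m a b) (fun i => a i.succ) (fun p => b p.succ) +
      ∑ c : Fin n, (-1 : k) ^ (c.val + 1) • elem m (mergeDiag t c a b) (mergeOff c b) +
      (-1 : k) ^ (n + 1) • elem (lastCoeff m a b) (fun i => a i.castSucc)
        (fun p => b p.castSucc) := by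
  simp only [boundary, LinearMap.add_apply, LinearMap.sum_apply, LinearMap.smul_apply,
    firstFace_elem, mergeFace_elem, lastFace_elem]

variable (M) in
/-- All faces `C_{n+1} → C_n`, numbered from `0` to `n + 1`. -/
def face (n : ℕ) (i : Fin (n + 2)) : Chains M (n + 1) →ₗ[k] Chains M n :=
  Fin.cases (firstFace M n) (fun j => Fin.lastCases (lastFace M n) (mergeFace M n) j) i

theorem face_zero (n : ℕ) : face M n 0 = firstFace M n := rfl

theorem face_last (n : ℕ) : face M n (Fin.last n).succ = lastFace M n := by
  simp only [face, Fin.cases_succ, Fin.lastCases_last]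

theorem face_mid (n : ℕ) (c : Fin n) : face M n c.castSucc.succ = mergeFace M n c := by
  simp only [face, Fin.cases_succ, Fin.lastCases_castSucc]

theorem boundary_eq_sum (n : ℕ) :
    boundary M n = ∑ i : Fin (n + 2), (-1 : k) ^ i.val • face M n i := by
  rw [Fin.sum_univ_succ, Fin.sum_univ_castSucc, boundary, add_assoc]
  simp only [face_zero, face_last, face_mid, Fin.val_succ, Fin.val_castSucc, Fin.val_last,
    Fin.val_zero, pow_zero, one_smul]

theorem face_face (n : ℕ) (i j : Fin (n + 2)) (hij : i ≤ j) :
    (face M n i).comp (face M (n + 1) j.succ) = (face M n j).comp (face M (n + 1) i.castSucc) := by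
  induction i using Fin.cases with
  | zero =>
    rw [Fin.castSucc_zero, face_zero, face_zero]
    induction j using Fin.cases with
    | zero =>
      rw [face_zero, ← first_merge_zero n, ← face_mid]
      rfl
    | succ j =>
      induction j using Fin.lastCases with
      | last => rw [face_last, ← first_last n, ← face_last, Fin.succ_last]
      | cast j => rw [face_mid, ← first_merge_succ n j, ← face_mid, Fin.succ_castSucc]
  | succ i =>
    obtain ⟨j, rfl⟩ := Fin.exists_succ_eq.2 (Fin.ne_zero_of_lt ((Fin.succ_pos i).trans_le hij))
    have hij' : i ≤ j := Fin.succ_le_succ_iff.1 hij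
    rw [← Fin.succ_castSucc, face_mid]
    induction j using Fin.lastCases with
    | last =>
      rw [face_last, Fin.succ_last, face_last]
      induction i using Fin.lastCases with
      | last => rw [face_last, last_merge_last n]
      | cast i => rw [face_mid, last_merge_castSucc n i]
    | cast j =>
      obtain ⟨i, rfl⟩ := Fin.exists_castSucc_eq.2
        (Fin.ne_last_of_lt (hij'.trans_lt (Fin.castSucc_lt_last j)))
      rw [face_mid, face_mid, ← merge_merge n i j hij', ← face_mid (n + 1) j.succ,
        Fin.succ_castSucc]

theorem sum_split {V : Type*} [AddCommGroup V] {n : ℕ} (i : Fin n) (g : Fin (n + 1) → V) :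
    ∑ j, g j = (∑ j : Fin n, if i ≤ j then g j.succ else 0) +
      ∑ j : Fin n, if j ≤ i then g j.castSucc else 0 := by
  have h : ∀ j, g j = (if i.castSucc < j then g j else 0) + if j ≤ i.castSucc then g j else 0 := by
    intro j
    by_cases hj : j ≤ i.castSucc
    · simp [hj, hj.not_gt]
    · simp [hj, not_le.1 hj]
  rw [Finset.sum_congr rfl fun j _ => h j, Finset.sum_add_distrib]
  congr 1
  · rw [Fin.sum_univ_succ, if_neg (Fin.zero_le _).not_gt, zero_add]
    simp only [Fin.castSucc_lt_succ_iff]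
  · rw [Fin.sum_univ_castSucc, if_neg (Fin.castSucc_lt_last i).not_ge, add_zero]
    simp only [Fin.castSucc_le_castSucc_iff]

theorem boundary_comp_boundary (n : ℕ) : (boundary M n).comp (boundary M (n + 1)) = 0 := by
  have h₀ : (boundary M n).comp (boundary M (n + 1)) = ∑ i : Fin (n + 2), ∑ j : Fin (n + 3),
      (-1 : k) ^ (i.val + j.val) • (face M n i).comp (face M (n + 1) j) := by
    refine LinearMap.ext fun z => ?_
    simp only [boundary_eq_sum, LinearMap.comp_apply, LinearMap.sum_apply, LinearMap.smul_apply,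
      map_sum, map_smul, Finset.smul_sum, smul_smul, pow_add]
    rw [Finset.sum_comm]
    simp only [mul_comm]
  rw [h₀, Finset.sum_congr rfl fun i _ => sum_split i _, Finset.sum_add_distrib,
    Finset.sum_comm (f := fun (i j : Fin (n + 2)) => if j ≤ i then _ else _),
    ← Finset.sum_add_distrib]
  refine Finset.sum_eq_zero fun i _ => ?_
  rw [← Finset.sum_add_distrib]
  refine Finset.sum_eq_zero fun j _ => ?_
  by_cases h : i ≤ j
  · rw [if_pos h, if_pos h, face_face n i j h, Fin.val_succ, Fin.val_castSucc, ← add_smul,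
      ← add_assoc, pow_succ, add_comm j.val, mul_neg_one, neg_add_cancel, zero_smul]
  · rw [if_neg h, if_neg h, add_zero]

/-! ### Secondary Hochschild homology -/

variable (M) in
/-- The cycles of degree `n`; the complex is zero in negative degrees. -/
def cycles : (n : ℕ) → Submodule k (Chains M n)
  | 0 => ⊤
  | n + 1 => LinearMap.ker (boundary M n)

theorem boundary_mem_cycles : ∀ (n : ℕ) (z : Chains M (n + 1)), boundary M n z ∈ cycles M n
  | 0, _ => Submodule.mem_top
  | n + 1, z => LinearMap.congr_fun (boundary_comp_boundary n) z

variable (M) in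
/-- The boundary as a map to the cycles. -/
def boundaryToCycles (n : ℕ) : Chains M (n + 1) →ₗ[k] cycles M n :=
  (boundary M n).codRestrict (cycles M n) (boundary_mem_cycles n)

variable (M) in
/-- The secondary Hochschild homology `H_n((A, B, ε); M)`: cycles modulo boundaries. -/
abbrev Homology (n : ℕ) : Type (max uk uA uB uM) :=
  cycles M n ⧸ LinearMap.range (boundaryToCycles M n)

/-! ### Functoriality in the coefficients -/

variable {N : SymBimodule.{uk, uA, uB, uN} t}

/-- The map of chains `m ⊗ (a, b) ↦ u(m) ⊗ (a, b)`. -/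
def chainsMap (u : Bimodule.Hom M.toBimodule N.toBimodule) (n : ℕ) : Chains M n →ₗ[k] Chains N n :=
  TensorProduct.map u.toLin LinearMap.id

theorem chainsMap_elem (u : Bimodule.Hom M.toBimodule N.toBimodule) {n : ℕ} (m : M.carrier)
    (a : Fin n → A) (b : Pairs n → B) : chainsMap u n (elem m a b) = elem (u.toLin m) a b := rfl

theorem boundary_chainsMap (u : Bimodule.Hom M.toBimodule N.toBimodule) (n : ℕ) :
    (boundary N n).comp (chainsMap u (n + 1)) = (chainsMap u n).comp (boundary M n) := by
  refine chains_ext fun m a b => ?_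
  simp only [LinearMap.comp_apply, chainsMap_elem, boundary_elem, map_add, map_sum, map_smul,
    firstCoeff, lastCoeff, u.map_left, u.map_right]

theorem chainsMap_mem_cycles (u : Bimodule.Hom M.toBimodule N.toBimodule) :
    ∀ (n : ℕ) (z : Chains M n), z ∈ cycles M n → chainsMap u n z ∈ cycles N n
  | 0, _, _ => Submodule.mem_top
  | n + 1, z, hz => by
    have h := LinearMap.congr_fun (boundary_chainsMap u n) z
    have hz' : boundary M n z = 0 := hz
    simpa [hz', cycles] using h

/-- The map on homology induced by a bimodule morphism `M → N`. -/
def homologyMap (u : Bimodule.Hom M.toBimodule N.toBimodule) (n : ℕ) :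
    Homology M n →ₗ[k] Homology N n :=
  Submodule.mapQ _ _ ((chainsMap u n).restrict (chainsMap_mem_cycles u n)) (by
    rintro _ ⟨z, rfl⟩
    exact ⟨chainsMap u (n + 1) z,
      Subtype.ext (LinearMap.congr_fun (boundary_chainsMap u n) z)⟩)

end Complex

end SecHH

/-! After one of the two given isomorphisms is adjusted, a Morita equivalence is a strict Morita
context: balanced pairings f : P × Q → A and g : Q × P → A' with f(p,q)p' = p g(q,p') and g(q,p)q' =
q f(p,q'), and with presentations 1 = Σ f(pᵢ,qᵢ), 1 = Σ g(q'ⱼ,p'ⱼ) of the units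
(`MoritaContext.nonempty_of_iso`).

The first presentation gives a generalized trace from the chains of M to those of Q ⊗ M ⊗ P: it
sends m ⊗ (a_r, b_{r,s}) to the sum over all label sequences i₀, …, iₙ of (q_{iₙ} ⊗ m ⊗ p_{i₀}) ⊗
(g(q_{i_{r-1}}, a_r p_{i_r}), η(b_{r,s})). In the cyclic word m, a₁, …, aₙ every label sits between
two neighbours. A face multiplies two neighbours, and the sum over their common label collapses to
the product in A or to the action on M. The entries in B are carried along by η; the conditions on P
and Q let the factors ε(b) pass through the pairings. Hence the trace commutes with all faces
(`Transfer.face_chain`). The second presentation gives a map back.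

In the composite of the two maps the labels are pairs s, and a becomes y_s a x_{s'} with Σ x_s y_s =
1 (`ofConj_comp_toConj`, `toConj_comp_ofConj`). Such an inner map is homotopic to the identity:
adjoin a label with x = y = 1, which by itself gives the identity, and let the labels change from
one set to the other, place by place. At the place of the change a unit is inserted on the diagonal.
This is a simplicial homotopy (`Transfer.boundary_homotopy_succ`). It needs only that faces remove
one label at a time; the traces need not preserve units, and no compatibility with degeneracies
enters.

Naturality in M holds on chains, since M enters only through m ↦ q ⊗ m ⊗ p. -/

namespace SecHH

open scoped TensorProduct

/-! ### Generalized trace maps and their compatibility with faces -/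

section Transfer

open Finset

variable {k : Type uk} {A : Type uA} {B : Type uB} {A' : Type uA'} {B' : Type uB'}
  [CommRing k] [Ring A] [CommRing B] [Algebra k A] [Algebra k B]
  [Ring A'] [CommRing B'] [Algebra k A'] [Algebra k B']
  {t : Triple k A B} {t' : Triple k A' B'}

/-- Families of linear maps `A → A'` and `M → M'`, indexed by pairs of labels, that are compatible
with an algebra morphism `η : B → B'`. -/
structure Transfer (M : SymBimodule.{uk, uA, uB, uM} t) (M' : SymBimodule.{uk, uA', uB', uN} t')
    (S : Type us) where
  /-- the morphism on the commutative algebras -/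
  η : B →ₐ[k] B'
  /-- the maps on the algebras -/
  τ : S → S → A →ₗ[k] A'
  /-- the maps on the coefficients -/
  μ : S → S → M.carrier →ₗ[k] M'.carrier
  τ_ε : ∀ s s' β a, τ s s' (t.ε β * a) = t'.ε (η β) * τ s s' a

namespace Transfer

variable {M : SymBimodule.{uk, uA, uB, uM} t} {M' : SymBimodule.{uk, uA', uB', uN} t'}
  {S : Type us} (F : Transfer M M' S)

/-- A finite set of labels is complete if the products of matrices with intermediate labels in this
set correspond to products in `A` and to the actions of `A` on `M`. -/
structure Complete (W : Finset S) : Prop where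
  -- The outer labels run over all of `S`, not only over `W`: in the homotopy the neighbours of a
  -- summed label may lie in another set.
  mul : ∀ s s' a a', ∑ r ∈ W, F.τ s r a * F.τ r s' a' = F.τ s s' (a * a')
  right : ∀ s s' a m,
    ∑ r ∈ W, MulOpposite.op (F.τ r s' a) • F.μ s r m = F.μ s s' (MulOpposite.op a • m)
  left : ∀ s s' a m, ∑ r ∈ W, F.τ s r a • F.μ r s' m = F.μ s s' (a • m)

/-- Centrality of both structure morphisms turns linearity from the left into linearity from the
right. -/
theorem τ_mul_ε (s s' : S) (β : B) (a : A) :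
    F.τ s s' (a * t.ε β) = F.τ s s' a * t'.ε (F.η β) := by
  rw [← t.central, F.τ_ε, t'.central]

theorem Complete.mul_ε_mul {F : Transfer M M' S} {W : Finset S} (hW : F.Complete W) (s s' : S)
    (a a' : A) (β : B) :
    ∑ r ∈ W, F.τ s r a * t'.ε (F.η β) * F.τ r s' a' = F.τ s s' (a * t.ε β * a') := by
  simp only [← F.τ_mul_ε, hW.mul]

/-- The map of chains for a fixed sequence of labels. -/
def single {n : ℕ} (σ : Fin (n + 1) → S) : Chains M n →ₗ[k] Chains M' n :=
  -- The labels are read cyclically: the coefficient stands between the last label and label `0`,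
  -- and diagonal entry `j` between labels `j` and `j + 1`.
  TensorProduct.map (F.μ (σ (Fin.last n)) (σ 0)) <| TensorProduct.map
    (PiTensorProduct.map fun j => F.τ (σ j.castSucc) (σ j.succ))
    (PiTensorProduct.map fun _ => F.η.toLinearMap)

theorem single_elem {n : ℕ} (σ : Fin (n + 1) → S) (m : M.carrier) (a : Fin n → A)
    (b : Pairs n → B) :
    F.single σ (elem m a b) = elem (F.μ (σ (Fin.last n)) (σ 0) m)
      (fun j => F.τ (σ j.castSucc) (σ j.succ) (a j)) (fun p => F.η (b p)) := by
  simp [single, elem, PiTensorProduct.map_tprod]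

/-- The map of chains, summed over all sequences of labels with prescribed ranges. -/
def chain {n : ℕ} (W : Fin (n + 1) → Finset S) : Chains M n →ₗ[k] Chains M' n :=
  ∑ σ ∈ Fintype.piFinset W, F.single σ

end Transfer

/-- Isolates the sum over label `i`, the only label that face `i` eliminates. -/
theorem sum_piFinset_insertNth {V : Type*} [AddCommMonoid V] {S : Type*} {n : ℕ}
    (W : Fin (n + 1) → Finset S) (i : Fin (n + 1)) (g : (Fin (n + 1) → S) → V) :
    ∑ σ ∈ Fintype.piFinset W, g σ =
      ∑ ρ ∈ Fintype.piFinset fun j => W (i.succAbove j),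
        ∑ r ∈ W i, g (i.insertNth (α := fun _ => S) r ρ) := by
  rw [← Finset.sum_product']
  refine Finset.sum_nbij' (fun σ => (fun j => σ (i.succAbove j), σ i))
    (fun x => i.insertNth (α := fun _ => S) x.2 x.1) ?_ ?_ ?_ ?_ ?_
  · intro σ hσ
    simp only [Fintype.mem_piFinset, mem_product] at hσ ⊢
    exact ⟨fun j => hσ _, hσ i⟩
  · intro x hx
    simp only [Fintype.mem_piFinset, mem_product] at hx ⊢
    intro j
    induction j using i.succAboveCases with
    | x => simpa using hx.2
    | p j => simpa using hx.1 j
  · intro σ _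
    exact Fin.insertNth_self_removeNth i σ
  · rintro ⟨ρ, r⟩ _
    simp
  · intro σ _
    exact congrArg g (Fin.insertNth_self_removeNth i σ).symm

theorem elem_sum_left {M : SymBimodule.{uk, uA, uB, uM} t} {ι : Type*} (s : Finset ι) {n : ℕ}
    (m : ι → M.carrier) (a : Fin n → A) (b : Pairs n → B) :
    (∑ r ∈ s, elem (m r) a b : Chains M n) = elem (∑ r ∈ s, m r) a b := by
  simp only [elem, TensorProduct.sum_tmul]

theorem elem_sum_diag {M : SymBimodule.{uk, uA, uB, uM} t} {ι : Type*} (s : Finset ι) {n : ℕ}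
    (m : M.carrier) (a : Fin n → A) (c : Fin n) (x : ι → A) (b : Pairs n → B) :
    (∑ r ∈ s, elem m (Function.update a c (x r)) b : Chains M n) =
      elem m (Function.update a c (∑ r ∈ s, x r)) b := by
  simp only [elem, MultilinearMap.map_update_sum, TensorProduct.tmul_sum, TensorProduct.sum_tmul]

theorem mergeOff_map (η : B →ₐ[k] B') {n : ℕ} (c : Fin n) (b : Pairs (n + 1) → B) :
    mergeOff c (fun p => η (b p)) = fun p => η (mergeOff c b p) := by
  funext q
  simp only [mergeOff, map_prod]

theorem succAbove_val {n : ℕ} (i : Fin (n + 1)) (j : Fin n) :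
    (i.succAbove j).val = if j.val < i.val then j.val else j.val + 1 := by
  simp only [Fin.succAbove, Fin.lt_def, Fin.val_castSucc]
  split_ifs <;> rfl

/-- This lemma and the next two are stated through values, so that mixed composites of `castSucc`
and `succ` can be treated by `omega`. -/
theorem insertNth_of_val_lt {α : Type*} {n : ℕ} (i : Fin (n + 1)) (r : α) (ρ : Fin n → α)
    {v : Fin (n + 1)} {j : Fin n} (h : v.val = j.val) (h' : j.val < i.val) :
    i.insertNth (α := fun _ => α) r ρ v = ρ j := by
  have e : v = i.succAbove j := Fin.ext (by rw [succAbove_val, if_pos h', h])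
  rw [e, Fin.insertNth_apply_succAbove]

theorem insertNth_of_val_gt {α : Type*} {n : ℕ} (i : Fin (n + 1)) (r : α) (ρ : Fin n → α)
    {v : Fin (n + 1)} {j : Fin n} (h : v.val = j.val + 1) (h' : i.val ≤ j.val) :
    i.insertNth (α := fun _ => α) r ρ v = ρ j := by
  have e : v = i.succAbove j := Fin.ext (by rw [succAbove_val, if_neg h'.not_gt, h])
  rw [e, Fin.insertNth_apply_succAbove]

theorem insertNth_of_val_eq {α : Type*} {n : ℕ} (i : Fin (n + 1)) (r : α) (ρ : Fin n → α)
    {v : Fin (n + 1)} (h : v.val = i.val) :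
    i.insertNth (α := fun _ => α) r ρ v = r := by
  rw [Fin.ext h, Fin.insertNth_apply_same]

namespace Transfer

variable {M : SymBimodule.{uk, uA, uB, uM} t} {M' : SymBimodule.{uk, uA', uB', uN} t'}
  {S : Type us} (F : Transfer M M' S)

/-- Label `0` occurs only in the coefficient and in the first diagonal entry, exactly the two
factors that this face multiplies. The factor from the first row is absorbed into the argument of
`τ`, and `Complete.right` applies. -/
theorem firstFace_single {n : ℕ} {W : Finset S} (hW : F.Complete W) (ρ : Fin (n + 1) → S)
    (m : M.carrier) (a : Fin (n + 1) → A) (b : Pairs (n + 1) → B) :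
    ∑ r ∈ W, firstFace M' n (F.single (Fin.insertNth (α := fun _ => S) 0 r ρ) (elem m a b)) =
      F.single ρ (firstFace M n (elem m a b)) := by
  simp only [single_elem, firstFace_elem]
  simp only [Fin.insertNth_zero, Fin.cons_zero, Fin.cons_succ, ← Fin.succ_last, firstCoeff,
    ← Fin.succ_castSucc, Fin.castSucc_zero, ← map_prod]
  rw [elem_sum_left]
  simp only [← F.τ_mul_ε]
  rw [← hW.right]
  rfl

theorem lastFace_single {n : ℕ} {W : Finset S} (hW : F.Complete W) (ρ : Fin (n + 1) → S)
    (m : M.carrier) (a : Fin (n + 1) → A) (b : Pairs (n + 1) → B) :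
    ∑ r ∈ W, lastFace M' n (F.single
        (Fin.insertNth (α := fun _ => S) (Fin.last (n + 1)) r ρ) (elem m a b)) =
      F.single ρ (lastFace M n (elem m a b)) := by
  simp only [single_elem, lastFace_elem]
  simp only [Fin.insertNth_last', Fin.snoc_last, Fin.snoc_castSucc, ← Fin.castSucc_zero, lastCoeff,
    Fin.succ_castSucc, Fin.succ_last, ← map_prod]
  rw [elem_sum_left]
  simp only [← F.τ_mul_ε]
  rw [← hW.left]

/-- Label `c + 1` is shared by the diagonal entries `c` and `c + 1` and by nothing else. After the
merge it survives in a single entry, so the sum over it moves into that entry by multilinearity and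
is evaluated by completeness. -/
theorem mergeFace_single {n : ℕ} {W : Finset S} (hW : F.Complete W) (c : Fin n)
    (ρ : Fin (n + 1) → S) (m : M.carrier) (a : Fin (n + 1) → A) (b : Pairs (n + 1) → B) :
    ∑ r ∈ W, mergeFace M' n c (F.single
        (Fin.insertNth (α := fun _ => S) c.castSucc.succ r ρ) (elem m a b)) =
      F.single ρ (mergeFace M n c (elem m a b)) := by
  have hdiag : ∀ r : S, mergeDiag t' c
      (fun j => F.τ (Fin.insertNth (α := fun _ => S) c.castSucc.succ r ρ j.castSucc)
        (Fin.insertNth (α := fun _ => S) c.castSucc.succ r ρ j.succ) (a j))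
      (fun p => F.η (b p)) =
      Function.update (fun j => F.τ (ρ j.castSucc) (ρ j.succ) (mergeDiag t c a b j)) c
        (F.τ (ρ c.castSucc) r (a c.castSucc) * t'.ε (F.η (b (Pairs.adj c))) *
          F.τ r (ρ c.succ) (a c.succ)) := by
    intro r
    funext l
    rcases lt_trichotomy l c with hl | rfl | hl
    · have hl' : l.val < c.val := hl
      rw [mergeDiag_lt hl, Function.update_of_ne hl.ne, mergeDiag_lt hl,
        insertNth_of_val_lt (j := l.castSucc), insertNth_of_val_lt (j := l.succ)]
      all_goals
        simp only [Fin.val_castSucc, Fin.val_succ]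
        try omega
    · rw [mergeDiag_self, Function.update_self,
        insertNth_of_val_lt (v := l.castSucc.castSucc) (j := l.castSucc),
        insertNth_of_val_eq (v := l.castSucc.succ), insertNth_of_val_eq (v := l.succ.castSucc),
        insertNth_of_val_gt (v := l.succ.succ) (j := l.succ)]
      all_goals
        simp only [Fin.val_castSucc, Fin.val_succ]
        try omega
    · have hl' : c.val < l.val := hl
      rw [mergeDiag_gt hl, Function.update_of_ne hl.ne', mergeDiag_gt hl,
        insertNth_of_val_gt (j := l.castSucc), insertNth_of_val_gt (j := l.succ)]
      all_goals
        simp only [Fin.val_castSucc, Fin.val_succ]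
        try omega
  have hcoeff : ∀ r : S, F.μ (Fin.insertNth (α := fun _ => S) c.castSucc.succ r ρ
      (Fin.last (n + 1))) (Fin.insertNth (α := fun _ => S) c.castSucc.succ r ρ 0) m =
      F.μ (ρ (Fin.last n)) (ρ 0) m := by
    intro r
    rw [insertNth_of_val_lt (v := 0) (j := 0), insertNth_of_val_gt (j := Fin.last n)]
    all_goals
      simp only [Fin.val_castSucc, Fin.val_succ, Fin.val_last, Fin.val_zero]
      try omega
  simp only [single_elem, mergeFace_elem, hdiag, hcoeff, mergeOff_map]
  rw [elem_sum_diag, hW.mul_ε_mul, ← mergeDiag_self (t := t) c a b]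
  congr 1
  exact Function.update_eq_self c fun j => F.τ (ρ j.castSucc) (ρ j.succ) (mergeDiag t c a b j)

/-- Only the range of the eliminated label has to be complete; the other ranges are arbitrary. This
freedom is what the homotopy uses. -/
theorem face_chain {n : ℕ} (W : Fin (n + 2) → Finset S) (i : Fin (n + 2))
    (hW : F.Complete (W i)) :
    (face M' n i).comp (F.chain W) =
      (F.chain fun j => W (i.succAbove j)).comp (face M n i) := by
  refine chains_ext fun m a b => ?_
  simp only [LinearMap.comp_apply, chain, LinearMap.sum_apply, map_sum]
  rw [sum_piFinset_insertNth W i]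
  refine Finset.sum_congr rfl fun ρ _ => ?_
  induction i using Fin.cases with
  | zero => exact F.firstFace_single hW ρ m a b
  | succ i =>
    induction i using Fin.lastCases with
    | last =>
      simp only [face_last]
      exact F.lastFace_single hW ρ m a b
    | cast c =>
      simp only [face_mid]
      exact F.mergeFace_single hW c ρ m a b

end Transfer

end Transfer

/-! ### Degeneracies and the simplicial identities -/

section Degeneracies

open Finset

variable {k : Type uk} {A : Type uA} {B : Type uB} [CommRing k] [Ring A] [CommRing B]
  [Algebra k A] [Algebra k B] {t : Triple k A B} {M : SymBimodule.{uk, uA, uB, uM} t}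

/-- The entries above the diagonal after rows and columns are renumbered by `f`: entries that come
to the same position are multiplied. -/
def pushOff {n m : ℕ} (f : Fin n → Fin m) (b : Pairs n → B) : Pairs m → B := fun q =>
  ∏ p : Pairs n with (f p.1.1, f p.1.2) = q.1, b p

theorem prod_pushOff {n m : ℕ} (f : Fin n → Fin m) (b : Pairs n → B) (P : Pairs m → Prop)
    (P' : Pairs n → Prop) [DecidablePred P] [DecidablePred P']
    (h : ∀ (p : Pairs n) (q : Pairs m), (f p.1.1, f p.1.2) = q.1 → (P q ↔ P' p))
    (h' : ∀ p, P' p → f p.1.1 < f p.1.2) :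
    ∏ q : Pairs m with P q, pushOff f b q = ∏ p : Pairs n with P' p, b p := by
  classical
  simp only [pushOff]
  rw [← Finset.prod_biUnion]
  · refine Finset.prod_congr ?_ fun _ _ => rfl
    ext p
    simp only [mem_biUnion, mem_filter, mem_univ, true_and]
    constructor
    · rintro ⟨q, hq, e⟩
      exact (h p q e).1 hq
    · intro hp
      exact ⟨⟨_, h' p hp⟩, (h p _ rfl).2 hp, rfl⟩
  · intro q _ q' _ hne
    refine Finset.disjoint_left.2 fun p hp hp' => hne ?_
    simp only [mem_filter, mem_univ, true_and] at hp hp'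
    exact Subtype.ext (hp.symm.trans hp')

/-- Monotonicity makes the intermediate position exist: a pair that ends strictly above the diagonal
cannot have met the diagonal or crossed it at the first step, so no factor is lost. -/
theorem pushOff_pushOff {n m l : ℕ} {f : Fin n → Fin m} {g : Fin m → Fin l} (hf : Monotone f)
    (b : Pairs n → B) :
    pushOff g (pushOff f b) = pushOff (fun i => g (f i)) b := by
  funext r
  refine prod_pushOff f b _ _ (fun p q e => ?_) (fun p hp => ?_)
  · rw [← e]
  · refine (hf p.2.le).lt_of_ne fun e => ?_
    have h := r.2
    rw [← hp] at h
    dsimp only at h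
    rw [e] at h
    exact lt_irrefl _ h

theorem pushOff_id {n : ℕ} (b : Pairs n → B) : pushOff (fun i => i) b = b := by
  funext q
  exact prod_filter_single b _ q fun p => Subtype.ext_iff.symm

theorem mergeOff_eq_pushOff {n : ℕ} (c : Fin n) (b : Pairs (n + 1) → B) :
    mergeOff c b = pushOff c.predAbove b := rfl

/-- With truncated subtraction the second summand is `0` for `j < i` and `1` otherwise. Written with
`min`, the identities between indices are decided by `omega` without a prior case split. -/
theorem succAbove_val' {n : ℕ} (i : Fin (n + 1)) (j : Fin n) :
    (i.succAbove j).val = j.val + min 1 (j.val + 1 - i.val) := by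
  rw [succAbove_val]
  split_ifs <;> omega

/-- The position to which a position is moved by the insertion of a row and a column. -/
def Pairs.succAbove {n : ℕ} (i : Fin (n + 1)) (p : Pairs n) : Pairs (n + 1) :=
  ⟨(i.succAbove p.1.1, i.succAbove p.1.2), Fin.strictMono_succAbove i p.2⟩

theorem Pairs.succAbove_injective {n : ℕ} (i : Fin (n + 1)) :
    Function.Injective (Pairs.succAbove i) := by
  intro p q e
  have h := congrArg Subtype.val e
  simpa [Pairs.succAbove, Prod.ext_iff, Subtype.ext_iff, Fin.succAbove_right_inj] using h

theorem pushOff_succAbove_update {n : ℕ} (i : Fin (n + 1)) (b : Pairs n → B) (p : Pairs n)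
    (x : B) : pushOff i.succAbove (Function.update b p x) =
      Function.update (pushOff i.succAbove b) (p.succAbove i) x := by
  funext q
  by_cases hq : q = p.succAbove i
  · subst hq
    rw [Function.update_self, pushOff, prod_filter_single _ _ p, Function.update_self]
    exact fun r => Subtype.ext_iff.symm.trans (Pairs.succAbove_injective i).eq_iff
  · rw [Function.update_of_ne hq, pushOff, pushOff, prod_update_notMem]
    simp only [mem_filter, mem_univ, true_and]
    exact fun e => hq (Subtype.ext e.symm)

theorem insertNth_update {α : Type*} {n : ℕ} (i : Fin (n + 1)) (r : α) (a : Fin n → α) (j : Fin n)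
    (x : α) : i.insertNth (α := fun _ => α) r (Function.update a j x) =
      Function.update (i.insertNth (α := fun _ => α) r a) (i.succAbove j) x := by
  funext l
  induction l using i.succAboveCases with
  | x => rw [Fin.insertNth_apply_same, Function.update_of_ne (Fin.succAbove_ne i j).symm,
      Fin.insertNth_apply_same]
  | p l => simp [Function.update_apply]

variable (M) in
/-- The degeneracy that inserts a row and a column with unit entries. -/
def degeneracy (n : ℕ) (i : Fin (n + 1)) : Chains M n →ₗ[k] Chains M (n + 1) :=
  liftChains (fun m a b => elem m (i.insertNth (α := fun _ => A) 1 a) (pushOff i.succAbove b))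
    (fun a b => elem_linear_left (isLinearMap_id' M.carrier) _ _)
    (fun m a j b => by
      simp only [insertNth_update]
      exact elem_linear_diag (isLinearMap_id' A) m _ _ _)
    (fun m a b p => by
      simp only [pushOff_succAbove_update]
      exact elem_linear_off (isLinearMap_id' B) m _ _ _)

theorem degeneracy_elem {n : ℕ} (i : Fin (n + 1)) (m : M.carrier) (a : Fin n → A)
    (b : Pairs n → B) : degeneracy M n i (elem m a b) =
      elem m (i.insertNth (α := fun _ => A) 1 a) (pushOff i.succAbove b) :=
  liftChains_elem _ _ _ _ m a b

theorem monotone_succAbove {n : ℕ} (i : Fin (n + 1)) : Monotone i.succAbove :=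
  (Fin.strictMono_succAbove i).monotone

theorem monotone_predAbove {n : ℕ} (c : Fin n) : Monotone c.predAbove := by
  intro i j h
  have h' : i.val ≤ j.val := h
  simp only [Fin.le_def, predAbove_val']
  omega

/-- The inserted row and column are outside the image of `succAbove`, so their entries are empty
products. -/
theorem pushOff_succAbove_eq_one {n : ℕ} (i : Fin (n + 1)) (b : Pairs n → B) (q : Pairs (n + 1))
    (h : q.1.1 = i ∨ q.1.2 = i) : pushOff i.succAbove b q = 1 := by
  rw [pushOff, Finset.filter_false_of_mem, Finset.prod_empty]
  intro p _ e
  rw [← e] at h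
  rcases h with h | h
  · exact Fin.succAbove_ne _ _ h
  · exact Fin.succAbove_ne _ _ h

/-- The inserted unit is one of the two merged diagonal entries and the entry of `B` between them is
`1`, so the merge returns the other entry unchanged. -/
theorem merge_degeneracy_self (n : ℕ) (c : Fin n) (i : Fin (n + 1))
    (hi : i = c.castSucc ∨ i = c.succ) :
    (mergeFace M n c).comp (degeneracy M n i) = LinearMap.id := by
  have hi' : i.val = c.val ∨ i.val = c.val + 1 := hi.imp (congrArg Fin.val) (congrArg Fin.val)
  refine chains_ext fun m a b => ?_
  simp only [LinearMap.comp_apply, degeneracy_elem, mergeFace_elem, LinearMap.id_apply]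
  have hoff : mergeOff c (pushOff i.succAbove b) = b := by
    rw [mergeOff_eq_pushOff, pushOff_pushOff (monotone_succAbove i)]
    convert pushOff_id b using 2
    funext j
    simp only [Fin.ext_iff, predAbove_val', succAbove_val']
    omega
  have hdiag : mergeDiag t c (i.insertNth (α := fun _ => A) 1 a) (pushOff i.succAbove b) = a := by
    funext l
    rcases lt_trichotomy l c with hl | rfl | hl
    · have hl' : l.val < c.val := hl
      rw [mergeDiag_lt hl, insertNth_of_val_lt (j := l)]
      all_goals
        try simp only [Fin.val_castSucc]
        try omega
    · rw [mergeDiag_self, pushOff_succAbove_eq_one i b (Pairs.adj l)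
        (hi.imp (fun h => h.symm) fun h => h.symm), map_one, mul_one]
      rcases hi' with h | h
      · rw [insertNth_of_val_eq (v := l.castSucc), insertNth_of_val_gt (v := l.succ) (j := l),
          one_mul]
        all_goals
          try simp only [Fin.val_castSucc, Fin.val_succ]
          try omega
      · rw [insertNth_of_val_lt (v := l.castSucc) (j := l), insertNth_of_val_eq (v := l.succ),
          mul_one]
        all_goals
          try simp only [Fin.val_castSucc, Fin.val_succ]
          try omega
    · have hl' : c.val < l.val := hl
      rw [mergeDiag_gt hl, insertNth_of_val_gt (j := l)]
      all_goals
        try simp only [Fin.val_succ]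
        try omega
  rw [hoff, hdiag]

theorem first_degeneracy_zero (n : ℕ) :
    (firstFace M n).comp (degeneracy M n 0) = LinearMap.id := by
  refine chains_ext fun m a b => ?_
  simp only [LinearMap.comp_apply, degeneracy_elem, firstFace_elem, LinearMap.id_apply]
  have hoff : (fun p : Pairs n => pushOff (Fin.succAbove 0) b p.succ) = b := by
    funext p
    refine prod_filter_single _ _ _ fun q => ?_
    simp only [Pairs.succ, Fin.succAbove_zero, Subtype.ext_iff, Prod.ext_iff, Fin.succ_inj]
  have hcoeff : firstCoeff m (Fin.insertNth (α := fun _ => A) 0 1 a)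
      (pushOff (Fin.succAbove 0) b) = m := by
    rw [firstCoeff, Finset.prod_eq_one, Fin.insertNth_apply_same, map_one, one_mul,
      MulOpposite.op_one, one_smul]
    intro p hp
    exact pushOff_succAbove_eq_one _ _ _ (Or.inl (by simpa using hp))
  rw [hoff, hcoeff]
  congr 1

theorem last_degeneracy_last (n : ℕ) :
    (lastFace M n).comp (degeneracy M n (Fin.last n)) = LinearMap.id := by
  refine chains_ext fun m a b => ?_
  simp only [LinearMap.comp_apply, degeneracy_elem, lastFace_elem, LinearMap.id_apply]
  have hoff : (fun p : Pairs n => pushOff (Fin.succAbove (Fin.last n)) b p.castSucc) = b := by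
    funext p
    refine prod_filter_single _ _ _ fun q => ?_
    simp only [Pairs.castSucc, Fin.succAbove_last, Subtype.ext_iff, Prod.ext_iff,
      Fin.castSucc_inj]
  have hcoeff : lastCoeff m (Fin.insertNth (α := fun _ => A) (Fin.last n) 1 a)
      (pushOff (Fin.succAbove (Fin.last n)) b) = m := by
    rw [lastCoeff, Finset.prod_eq_one, Fin.insertNth_apply_same, map_one, one_mul, one_smul]
    intro p hp
    exact pushOff_succAbove_eq_one _ _ _ (Or.inr (by simpa using hp))
  rw [hoff, hcoeff]
  congr 1
  simp [Fin.snoc_castSucc]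

theorem first_degeneracy_succ (n : ℕ) (i : Fin (n + 1)) :
    (firstFace M (n + 1)).comp (degeneracy M (n + 1) i.succ) =
      (degeneracy M n i).comp (firstFace M n) := by
  refine chains_ext fun m a b => ?_
  simp only [LinearMap.comp_apply, degeneracy_elem, firstFace_elem]
  have hoff : (fun p : Pairs (n + 1) => pushOff i.succ.succAbove b p.succ) =
      pushOff i.succAbove fun p => b p.succ := by
    funext r
    refine (prod_succ _ _ _ (fun p => ?_) (fun p hp h => ?_)).symm
    · simp only [Pairs.succ, Prod.ext_iff, Fin.succ_succAbove_succ, Fin.succ_inj]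
    · simp only [Pairs.succ, Prod.ext_iff, h, Fin.succ_succAbove_zero] at hp
      exact Fin.succ_ne_zero _ hp.1.symm
  have hcoeff : firstCoeff m (i.succ.insertNth (α := fun _ => A) 1 a)
      (pushOff i.succ.succAbove b) = firstCoeff m a b := by
    have h : ∏ q : Pairs (n + 2) with q.1.1 = 0, pushOff i.succ.succAbove b q =
        ∏ p : Pairs (n + 1) with p.1.1 = 0, b p :=
      prod_pushOff _ _ _ _ (fun p q e => by
        rw [← e]
        simp only [Fin.ext_iff, succAbove_val', Fin.val_succ, Fin.val_zero]
        omega) (fun p _ => Fin.strictMono_succAbove _ p.2)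
    rw [firstCoeff, firstCoeff, h, insertNth_of_val_lt (v := 0) (j := 0) _ _ _ rfl]
    exact Nat.succ_pos _
  have hdiag : (fun j : Fin (n + 1) => i.succ.insertNth (α := fun _ => A) 1 a j.succ) =
      i.insertNth (α := fun _ => A) 1 fun j => a j.succ := by
    funext j
    induction j using i.succAboveCases with
    | x => rw [Fin.insertNth_apply_same, Fin.insertNth_apply_same]
    | p j => rw [← Fin.succ_succAbove_succ, Fin.insertNth_apply_succAbove,
        Fin.insertNth_apply_succAbove]
  rw [hoff, hcoeff, hdiag]

theorem last_degeneracy_castSucc (n : ℕ) (i : Fin (n + 1)) :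
    (lastFace M (n + 1)).comp (degeneracy M (n + 1) i.castSucc) =
      (degeneracy M n i).comp (lastFace M n) := by
  refine chains_ext fun m a b => ?_
  simp only [LinearMap.comp_apply, degeneracy_elem, lastFace_elem]
  have hoff : (fun p : Pairs (n + 1) => pushOff i.castSucc.succAbove b p.castSucc) =
      pushOff i.succAbove fun p => b p.castSucc := by
    funext r
    refine (prod_castSucc _ _ _ (fun p => ?_) (fun p hp h => ?_)).symm
    · simp only [Pairs.castSucc, Prod.ext_iff, Fin.castSucc_succAbove_castSucc, Fin.castSucc_inj]
    · simp only [Pairs.castSucc, Prod.ext_iff, h, Fin.ext_iff, succAbove_val', Fin.val_castSucc,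
        Fin.val_last] at hp
      have := r.val_lt
      have := i.isLt
      omega
  have hcoeff : lastCoeff m (i.castSucc.insertNth (α := fun _ => A) 1 a)
      (pushOff i.castSucc.succAbove b) = lastCoeff m a b := by
    have h : ∏ q : Pairs (n + 2) with q.1.2 = Fin.last (n + 1), pushOff i.castSucc.succAbove b q =
        ∏ p : Pairs (n + 1) with p.1.2 = Fin.last n, b p :=
      prod_pushOff _ _ _ _ (fun p q e => by
        rw [← e]
        simp only [Fin.ext_iff, succAbove_val', Fin.val_castSucc, Fin.val_last]
        omega) (fun p _ => Fin.strictMono_succAbove _ p.2)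
    rw [lastCoeff, lastCoeff, h, insertNth_of_val_gt (v := Fin.last (n + 1)) (j := Fin.last n)]
    · rfl
    · exact Nat.le_of_lt_succ i.isLt
  have hdiag : (fun j : Fin (n + 1) => i.castSucc.insertNth (α := fun _ => A) 1 a j.castSucc) =
      i.insertNth (α := fun _ => A) 1 fun j => a j.castSucc := by
    funext j
    induction j using i.succAboveCases with
    | x => rw [Fin.insertNth_apply_same, Fin.insertNth_apply_same]
    | p j => rw [← Fin.castSucc_succAbove_castSucc, Fin.insertNth_apply_succAbove,
        Fin.insertNth_apply_succAbove]
  rw [hoff, hcoeff, hdiag]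

/-- The two alternatives are the cases in which the merged rows lie wholly before or wholly after
the inserted one. They are treated together because the computation with values is the same. -/
theorem merge_degeneracy (n : ℕ) (c : Fin n) (c' : Fin (n + 1)) (i : Fin (n + 1)) (i' : Fin (n + 2))
    (h : c' = c.castSucc ∧ i' = i.succ ∧ c.val < i.val ∨
      c' = c.succ ∧ i' = i.castSucc ∧ i.val ≤ c.val) :
    (mergeFace M (n + 1) c').comp (degeneracy M (n + 1) i') =
      (degeneracy M n i).comp (mergeFace M n c) := by
  have h' : c'.val = c.val ∧ i'.val = i.val + 1 ∧ c.val < i.val ∨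
      c'.val = c.val + 1 ∧ i'.val = i.val ∧ i.val ≤ c.val := by
    rcases h with ⟨rfl, rfl, h⟩ | ⟨rfl, rfl, h⟩
    · exact Or.inl ⟨rfl, rfl, h⟩
    · exact Or.inr ⟨rfl, rfl, h⟩
  refine chains_ext fun m a b => ?_
  simp only [LinearMap.comp_apply, degeneracy_elem, mergeFace_elem]
  have hoff : mergeOff c' (pushOff i'.succAbove b) = pushOff i.succAbove (mergeOff c b) := by
    rw [mergeOff_eq_pushOff, mergeOff_eq_pushOff, pushOff_pushOff (monotone_succAbove _),
      pushOff_pushOff (monotone_predAbove _)]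
    congr 1
    funext j
    have := j.isLt
    simp only [Fin.ext_iff, predAbove_val', succAbove_val']
    omega
  have hb : pushOff i'.succAbove b (Pairs.adj c') = b (Pairs.adj c) :=
    prod_filter_single _ _ _ fun q => by
      have := q.val_lt
      simp only [Pairs.adj, Subtype.ext_iff, Prod.ext_iff, Fin.ext_iff, succAbove_val',
        Fin.val_castSucc, Fin.val_succ]
      omega
  have hdiag : mergeDiag t c' (i'.insertNth (α := fun _ => A) 1 a) (pushOff i'.succAbove b) =
      i.insertNth (α := fun _ => A) 1 (mergeDiag t c a b) := by
    -- Reads off an old diagonal entry from the value of its shifted index, in the form of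
    -- `succAbove_val'`.
    have hv : ∀ {v : Fin (n + 2)} {j : Fin (n + 1)}, v.val = j.val + min 1 (j.val + 1 - i'.val) →
        i'.insertNth (α := fun _ => A) 1 a v = a j := fun {v j} e => by
      rw [Fin.ext (e.trans (succAbove_val' i' j).symm), Fin.insertNth_apply_succAbove]
    funext l
    induction l using i.succAboveCases with
    | x =>
      rw [Fin.insertNth_apply_same]
      rcases h' with h' | h'
      · rw [mergeDiag_gt (Fin.lt_def.2 (by omega)), insertNth_of_val_eq]
        rw [Fin.val_succ, h'.2.1]
      · rw [mergeDiag_lt (Fin.lt_def.2 (by omega)), insertNth_of_val_eq]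
        rw [Fin.val_castSucc, h'.2.1]
    | p j =>
      have hj := succAbove_val' i j
      rw [Fin.insertNth_apply_succAbove]
      rcases lt_trichotomy j c with hl | rfl | hl
      · have hl' : j.val < c.val := hl
        rw [mergeDiag_lt hl, mergeDiag_lt (Fin.lt_def.2 (by omega)), hv]
        simp only [Fin.val_castSucc]
        omega
      · obtain rfl : c' = i.succAbove j := Fin.ext (by omega)
        rw [mergeDiag_self, mergeDiag_self, hb, hv (j := j.castSucc), hv (j := j.succ)]
        all_goals
          simp only [Fin.val_castSucc, Fin.val_succ]
          omega
      · have hl' : c.val < j.val := hl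
        rw [mergeDiag_gt hl, mergeDiag_gt (Fin.lt_def.2 (by omega)), hv]
        simp only [Fin.val_succ]
        omega
  rw [hoff, hdiag]

theorem face_degeneracy_castSucc (n : ℕ) (i : Fin (n + 1)) :
    (face M n i.castSucc).comp (degeneracy M n i) = LinearMap.id := by
  induction i using Fin.cases with
  | zero => exact first_degeneracy_zero n
  | succ c =>
    rw [← Fin.succ_castSucc, face_mid]
    exact merge_degeneracy_self n c _ (Or.inr rfl)

theorem face_degeneracy_succ (n : ℕ) (i : Fin (n + 1)) :
    (face M n i.succ).comp (degeneracy M n i) = LinearMap.id := by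
  induction i using Fin.lastCases with
  | last =>
    rw [face_last]
    exact last_degeneracy_last n
  | cast c =>
    rw [face_mid]
    exact merge_degeneracy_self n c _ (Or.inl rfl)

theorem face_degeneracy_of_le (n : ℕ) (i : Fin (n + 1)) (j : Fin (n + 2)) (h : j ≤ i.castSucc) :
    (face M (n + 1) j.castSucc).comp (degeneracy M (n + 1) i.succ) =
      (degeneracy M n i).comp (face M n j) := by
  induction j using Fin.cases with
  | zero => exact first_degeneracy_succ n i
  | succ c =>
    have h' : c.val + 1 ≤ i.val := h
    have := i.isLt
    obtain ⟨c, rfl⟩ := Fin.exists_castSucc_eq.2 (show c ≠ Fin.last n from fun e => by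
      rw [e, Fin.val_last] at h'
      omega)
    rw [face_mid, ← Fin.succ_castSucc, face_mid]
    exact merge_degeneracy n c _ i _ (Or.inl ⟨rfl, rfl, h'⟩)

theorem face_degeneracy_of_lt (n : ℕ) (i : Fin (n + 1)) (j : Fin (n + 2)) (h : i.castSucc < j) :
    (face M (n + 1) j.succ).comp (degeneracy M (n + 1) i.castSucc) =
      (degeneracy M n i).comp (face M n j) := by
  obtain ⟨j, rfl⟩ := Fin.exists_succ_eq.2 (Fin.ne_zero_of_lt h)
  induction j using Fin.lastCases with
  | last =>
    rw [face_last, Fin.succ_last, face_last]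
    exact last_degeneracy_castSucc n i
  | cast c =>
    rw [face_mid, Fin.succ_castSucc, face_mid]
    exact merge_degeneracy n c _ i _ (Or.inr ⟨rfl, rfl, Nat.le_of_lt_succ h⟩)

end Degeneracies

/-! ### The simplicial homotopy between two complete sets of labels -/

section Homotopy

open Finset

variable {k : Type uk} {A : Type uA} {B : Type uB} {A' : Type uA'} {B' : Type uB'}
  [CommRing k] [Ring A] [CommRing B] [Algebra k A] [Algebra k B]
  [Ring A'] [CommRing B'] [Algebra k A'] [Algebra k B']
  {t : Triple k A B} {t' : Triple k A' B'}
  {M : SymBimodule.{uk, uA, uB, uM} t} {M' : SymBimodule.{uk, uA', uB', uN} t'}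
  {S : Type us} (F : Transfer M M' S)

/-- The combinatorics of a simplicial homotopy, with `D i j` for face `j` of prism `i` and `E i j`
for prism `i` of face `j`. The terms `j = i` and `j = i + 1` of `D` telescope; each remaining term
of `D` equals a term of `E` whose index sum is smaller by one, so the signs are opposite and they
cancel. -/
theorem sum_prism {Z : Type*} [AddCommGroup Z] [Module k Z] {n : ℕ}
    (D : Fin (n + 2) → Fin (n + 3) → Z) (E : Fin (n + 1) → Fin (n + 2) → Z) (p : ℕ → Z)
    (hD₀ : ∀ i, D i i.castSucc = p i.val) (hD₁ : ∀ i, D i i.succ = p (i.val + 1))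
    (hle : ∀ i j, j ≤ i.castSucc → D i.succ j.castSucc = E i j)
    (hlt : ∀ i j, i.castSucc < j → D i.castSucc j.succ = E i j) :
    (∑ i, ∑ j, (-1 : k) ^ (i.val + j.val) • D i j) + ∑ i, ∑ j, (-1 : k) ^ (i.val + j.val) • E i j =
      p 0 - p (n + 2) := by
  have hdiag : ∀ i : Fin (n + 2), (∑ j : Fin (n + 3), (-1 : k) ^ (i.val + j.val) • D i j) =
      (p i.val - p (i.val + 1)) +
      ((∑ j : Fin (n + 2), if i < j then (-1 : k) ^ (i.val + (j.val + 1)) • D i j.succ else 0) +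
      ∑ j : Fin (n + 2), if j < i then (-1 : k) ^ (i.val + j.val) • D i j.castSucc else 0) := by
    intro i
    -- `sum_split` leaves the term at `i` in each half; `e₁` and `e₂` extract these two telescoping
    -- terms.
    have e₁ : ∀ g : Fin (n + 2) → Z,
        (∑ j, if i ≤ j then g j else 0) = g i + ∑ j, if i < j then g j else 0 := fun g => by
      rw [← Finset.sum_filter, ← Finset.sum_filter, ← Finset.sum_insert (by simp)]
      congr 1
      ext j
      simp [le_iff_eq_or_lt, eq_comm]
    have e₂ : ∀ g : Fin (n + 2) → Z,
        (∑ j, if j ≤ i then g j else 0) = g i + ∑ j, if j < i then g j else 0 := fun g => by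
      rw [← Finset.sum_filter, ← Finset.sum_filter, ← Finset.sum_insert (by simp)]
      congr 1
      ext j
      simp [le_iff_eq_or_lt]
    rw [sum_split i, e₁, e₂, hD₀, hD₁]
    simp only [Fin.val_succ, Fin.val_castSucc]
    rw [← add_assoc i.val, pow_succ, ← two_mul, pow_mul, neg_one_sq, one_pow, one_smul, one_mul,
      neg_one_smul]
    abel
  have htel : ∑ i : Fin (n + 2), (p i.val - p (i.val + 1)) = p 0 - p (n + 2) := by
    rw [Fin.sum_univ_eq_sum_range (fun i => p i - p (i + 1)), Finset.sum_range_sub']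
  have hup : (∑ i : Fin (n + 2), ∑ j : Fin (n + 2), if i < j then
        (-1 : k) ^ (i.val + (j.val + 1)) • D i j.succ else 0) =
      ∑ i : Fin (n + 1), ∑ j : Fin (n + 2), if i.castSucc < j then
        -((-1 : k) ^ (i.val + j.val) • E i j) else 0 := by
    rw [Fin.sum_univ_castSucc]
    simp only [(Fin.le_last _).not_gt, if_false, Finset.sum_const_zero, add_zero]
    refine Finset.sum_congr rfl fun i _ => Finset.sum_congr rfl fun j _ => ?_
    split_ifs with h
    · rw [hlt i j h, ← add_assoc, pow_succ, mul_neg_one, neg_smul, Fin.val_castSucc]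
    · rfl
  have hlow : (∑ i : Fin (n + 2), ∑ j : Fin (n + 2), if j < i then
        (-1 : k) ^ (i.val + j.val) • D i j.castSucc else 0) =
      ∑ i : Fin (n + 1), ∑ j : Fin (n + 2), if i.castSucc < j then 0 else
        -((-1 : k) ^ (i.val + j.val) • E i j) := by
    rw [Fin.sum_univ_succ]
    simp only [(Fin.zero_le _).not_gt, if_false, Finset.sum_const_zero, zero_add]
    refine Finset.sum_congr rfl fun i _ => Finset.sum_congr rfl fun j _ => ?_
    have hij : j < i.succ ↔ ¬ i.castSucc < j := by
      simp only [Fin.lt_def, Fin.val_castSucc, Fin.val_succ]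
      omega
    by_cases h : i.castSucc < j
    · rw [if_pos h, if_neg (fun h' => hij.1 h' h)]
    · rw [if_neg h, if_pos (hij.2 h), hle i j (not_lt.1 h), Fin.val_succ, add_right_comm, pow_succ,
        mul_neg_one, neg_smul]
  rw [Finset.sum_congr rfl fun i _ => hdiag i,
    Finset.sum_add_distrib, Finset.sum_add_distrib, htel, hup, hlow, add_assoc, add_eq_left,
    ← Finset.sum_add_distrib, ← Finset.sum_add_distrib]
  refine Finset.sum_eq_zero fun i _ => ?_
  rw [← Finset.sum_add_distrib, ← Finset.sum_add_distrib]
  refine Finset.sum_eq_zero fun j _ => ?_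
  split_ifs <;> simp

namespace Transfer

theorem boundary_chain {W : Finset S} (hW : F.Complete W) (n : ℕ) :
    (boundary M' n).comp (F.chain fun _ => W) = (F.chain fun _ => W).comp (boundary M n) := by
  refine LinearMap.ext fun z => ?_
  simp only [boundary_eq_sum, LinearMap.comp_apply, LinearMap.sum_apply, LinearMap.smul_apply,
    map_sum, map_smul]
  exact Finset.sum_congr rfl fun i _ =>
    congrArg _ (LinearMap.congr_fun (F.face_chain (fun _ => W) i hW) z)

/-- The ranges of labels that are `W₁` at the first `c` places and `W₀` at the others. -/
def ranges (W₀ W₁ : Finset S) (n c : ℕ) : Fin n → Finset S := fun v =>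
  if v.val < c then W₁ else W₀

theorem ranges_zero (W₀ W₁ : Finset S) (n : ℕ) : ranges W₀ W₁ n 0 = fun _ => W₀ := rfl

theorem ranges_self (W₀ W₁ : Finset S) (n : ℕ) : ranges W₀ W₁ n n = fun _ => W₁ :=
  funext fun v => if_pos v.isLt

/-- Removing a place at or before `c` removes one of the first `c + 1` places, so the point of
change moves down by one. In the next lemma the removed place lies after the change, which stays
where it is. -/
theorem ranges_succAbove_of_le (W₀ W₁ : Finset S) {n c : ℕ} {i : Fin (n + 1)} (h : i.val ≤ c) :
    (fun j => ranges W₀ W₁ (n + 1) (c + 1) (i.succAbove j)) = ranges W₀ W₁ n c := by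
  funext j
  simp only [ranges, succAbove_val']
  congr 1
  rw [eq_iff_iff]
  omega

theorem ranges_succAbove_of_ge (W₀ W₁ : Finset S) {n c : ℕ} {i : Fin (n + 1)} (h : c ≤ i.val) :
    (fun j => ranges W₀ W₁ (n + 1) c (i.succAbove j)) = ranges W₀ W₁ n c := by
  funext j
  simp only [ranges, succAbove_val']
  congr 1
  rw [eq_iff_iff]
  omega

theorem complete_ranges {W₀ W₁ : Finset S} (h₀ : F.Complete W₀) (h₁ : F.Complete W₁) {n : ℕ}
    (c : ℕ) (v : Fin n) : F.Complete (ranges W₀ W₁ n c v) := by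
  rw [ranges]
  split_ifs
  · exact h₁
  · exact h₀

/-- The simplicial homotopy between the chain maps for two sets of labels. -/
def prism (W₀ W₁ : Finset S) (n : ℕ) (i : Fin (n + 1)) : Chains M n →ₗ[k] Chains M' (n + 1) :=
  -- The inserted unit has index `i` and stands between labels `i` and `i + 1`, exactly where the
  -- range changes from `W₁` to `W₀`.
  (F.chain (ranges W₀ W₁ (n + 2) (i.val + 1))).comp (degeneracy M n i)

variable {W₀ W₁ : Finset S} (h₀ : F.Complete W₀) (h₁ : F.Complete W₁)
include h₀ h₁

/-- Face `i` drops the last label from `W₁` and face `i + 1` the first label from `W₀`. Both cancel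
the degeneracy, so they leave the chain maps for the two consecutive points of change. -/
theorem face_castSucc_prism (n : ℕ) (i : Fin (n + 1)) :
    (face M' n i.castSucc).comp (F.prism W₀ W₁ n i) = F.chain (ranges W₀ W₁ (n + 1) i.val) := by
  rw [prism, ← LinearMap.comp_assoc, F.face_chain _ _ (F.complete_ranges h₀ h₁ _ _),
    ranges_succAbove_of_le W₀ W₁ (by simp), LinearMap.comp_assoc, face_degeneracy_castSucc,
    LinearMap.comp_id]

theorem face_succ_prism (n : ℕ) (i : Fin (n + 1)) :
    (face M' n i.succ).comp (F.prism W₀ W₁ n i) =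
      F.chain (ranges W₀ W₁ (n + 1) (i.val + 1)) := by
  rw [prism, ← LinearMap.comp_assoc, F.face_chain _ _ (F.complete_ranges h₀ h₁ _ _),
    ranges_succAbove_of_ge W₀ W₁ (by simp), LinearMap.comp_assoc, face_degeneracy_succ,
    LinearMap.comp_id]

theorem face_prism_of_le (n : ℕ) (i : Fin (n + 1)) (j : Fin (n + 2)) (h : j ≤ i.castSucc) :
    (face M' (n + 1) j.castSucc).comp (F.prism W₀ W₁ (n + 1) i.succ) =
      (F.prism W₀ W₁ n i).comp (face M n j) := by
  have h' : j.val ≤ i.val := h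
  rw [prism, ← LinearMap.comp_assoc, F.face_chain _ _ (F.complete_ranges h₀ h₁ _ _),
    ranges_succAbove_of_le W₀ W₁ (by simp; omega), LinearMap.comp_assoc,
    face_degeneracy_of_le n i j h, ← LinearMap.comp_assoc]
  rfl

theorem face_prism_of_lt (n : ℕ) (i : Fin (n + 1)) (j : Fin (n + 2)) (h : i.castSucc < j) :
    (face M' (n + 1) j.succ).comp (F.prism W₀ W₁ (n + 1) i.castSucc) =
      (F.prism W₀ W₁ n i).comp (face M n j) := by
  have h' : i.val < j.val := h
  rw [prism, ← LinearMap.comp_assoc, F.face_chain _ _ (F.complete_ranges h₀ h₁ _ _),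
    ranges_succAbove_of_ge W₀ W₁ (by simp; omega), LinearMap.comp_assoc,
    face_degeneracy_of_lt n i j h, ← LinearMap.comp_assoc]
  rfl

omit h₀ h₁

variable (W₀ W₁) in
/-- The alternating sum of the maps of the simplicial homotopy. -/
def homotopy (n : ℕ) : Chains M n →ₗ[k] Chains M' (n + 1) :=
  ∑ i : Fin (n + 1), (-1 : k) ^ i.val • F.prism W₀ W₁ n i

theorem boundary_homotopy (n : ℕ) (z : Chains M n) :
    boundary M' n (F.homotopy W₀ W₁ n z) = ∑ i : Fin (n + 1), ∑ j : Fin (n + 2),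
      (-1 : k) ^ (i.val + j.val) • face M' n j (F.prism W₀ W₁ n i z) := by
  simp only [boundary_eq_sum, homotopy, LinearMap.sum_apply, LinearMap.smul_apply, map_sum,
    map_smul, Finset.smul_sum, smul_smul, pow_add]

theorem homotopy_boundary (n : ℕ) (z : Chains M (n + 1)) :
    F.homotopy W₀ W₁ n (boundary M n z) = ∑ i : Fin (n + 1), ∑ j : Fin (n + 2),
      (-1 : k) ^ (i.val + j.val) • F.prism W₀ W₁ n i (face M n j z) := by
  simp only [boundary_eq_sum, homotopy, LinearMap.sum_apply, LinearMap.smul_apply, map_sum,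
    map_smul, Finset.smul_sum, smul_smul, pow_add]
  rw [Finset.sum_comm]
  simp only [mul_comm]

theorem boundary_homotopy_zero (h₀ : F.Complete W₀) (h₁ : F.Complete W₁) (z : Chains M 0) :
    boundary M' 0 (F.homotopy W₀ W₁ 0 z) = F.chain (fun _ => W₀) z - F.chain (fun _ => W₁) z := by
  have e₀ : face M' 0 0 (F.prism W₀ W₁ 0 0 z) = F.chain (fun _ => W₀) z :=
    LinearMap.congr_fun (F.face_castSucc_prism h₀ h₁ 0 0) z
  have e₁ : face M' 0 1 (F.prism W₀ W₁ 0 0 z) = F.chain (ranges W₀ W₁ 1 1) z :=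
    LinearMap.congr_fun (F.face_succ_prism h₀ h₁ 0 0) z
  rw [ranges_self] at e₁
  rw [boundary_homotopy, Fin.sum_univ_one, Fin.sum_univ_two, e₀, e₁]
  simp only [Fin.val_zero, Fin.val_one, add_zero, zero_add, pow_zero, pow_one, one_smul]
  rw [neg_smul, one_smul, sub_eq_add_neg]

theorem boundary_homotopy_succ (h₀ : F.Complete W₀) (h₁ : F.Complete W₁) (n : ℕ)
    (z : Chains M (n + 1)) :
    boundary M' (n + 1) (F.homotopy W₀ W₁ (n + 1) z) + F.homotopy W₀ W₁ n (boundary M n z) =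
      F.chain (fun _ => W₀) z - F.chain (fun _ => W₁) z := by
  rw [boundary_homotopy, homotopy_boundary, sum_prism
    (fun i j => face M' (n + 1) j (F.prism W₀ W₁ (n + 1) i z))
    (fun i j => F.prism W₀ W₁ n i (face M n j z))
    (fun c => F.chain (ranges W₀ W₁ (n + 2) c) z)
    (fun i => LinearMap.congr_fun (F.face_castSucc_prism h₀ h₁ _ i) z)
    (fun i => LinearMap.congr_fun (F.face_succ_prism h₀ h₁ _ i) z)
    (fun i j h => LinearMap.congr_fun (F.face_prism_of_le h₀ h₁ n i j h) z)
    (fun i j h => LinearMap.congr_fun (F.face_prism_of_lt h₀ h₁ n i j h) z),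
    ranges_zero, ranges_self]

/-- On a cycle the term of the homotopy that contains the boundary vanishes, so the two chain maps
differ by a boundary. In degree `0` this term is absent. -/
theorem chain_sub_chain_mem (h₀ : F.Complete W₀) (h₁ : F.Complete W₁) :
    ∀ (n : ℕ) (z : Chains M n), z ∈ cycles M n →
      ∃ w : Chains M' (n + 1), boundary M' n w = F.chain (fun _ => W₀) z - F.chain (fun _ => W₁) z
  | 0, z, _ => ⟨F.homotopy W₀ W₁ 0 z, F.boundary_homotopy_zero h₀ h₁ z⟩
  | n + 1, z, hz => ⟨F.homotopy W₀ W₁ (n + 1) z, by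
      have h := F.boundary_homotopy_succ h₀ h₁ n z
      have hz' : boundary M n z = 0 := hz
      rwa [hz', map_zero, add_zero] at h⟩

theorem chain_mem_cycles {W : Finset S} (hW : F.Complete W) :
    ∀ (n : ℕ) (z : Chains M n), z ∈ cycles M n → F.chain (fun _ => W) z ∈ cycles M' n
  | 0, _, _ => Submodule.mem_top
  | n + 1, z, hz => by
    have h := LinearMap.congr_fun (F.boundary_chain hW n) z
    have hz' : boundary M n z = 0 := hz
    simpa [hz', cycles] using h

/-- The map on homology induced by a complete set of labels. -/
def homologyMap {W : Finset S} (hW : F.Complete W) (n : ℕ) : Homology M n →ₗ[k] Homology M' n :=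
  Submodule.mapQ _ _ ((F.chain fun _ => W).restrict (F.chain_mem_cycles hW n)) (by
    rintro _ ⟨z, rfl⟩
    exact ⟨F.chain (fun _ => W) z, Subtype.ext (LinearMap.congr_fun (F.boundary_chain hW n) z)⟩)

end Transfer

end Homotopy

/-! ### Inner transfers induce the identity on homology -/

section Inner

open Finset

variable {k : Type uk} {A : Type uA} {B : Type uB} {A' : Type uA'} {B' : Type uB'}
  [CommRing k] [Ring A] [CommRing B] [Algebra k A] [Algebra k B]
  [Ring A'] [CommRing B'] [Algebra k A'] [Algebra k B']
  {t : Triple k A B} {t' : Triple k A' B'}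
  {M : SymBimodule.{uk, uA, uB, uM} t} {M' : SymBimodule.{uk, uA', uB', uN} t'}

namespace Transfer

attribute [ext] Transfer

section Comp

variable {ι : Type us} {κ : Type ut} [Fintype ι] [Fintype κ]
  (G : Transfer M' M κ) (F : Transfer M M' ι)

/-- The composition of transfers, with pairs of labels as labels. -/
def comp : Transfer M M (ι × κ) where
  η := G.η.comp F.η
  τ s s' := (G.τ s.2 s'.2).comp (F.τ s.1 s'.1)
  μ s s' := (G.μ s.2 s'.2).comp (F.μ s.1 s'.1)
  τ_ε s s' β a := by simp only [LinearMap.comp_apply, F.τ_ε, G.τ_ε, AlgHom.comp_apply]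

theorem chain_univ {n : ℕ} :
    (F.chain fun _ => univ : Chains M n →ₗ[k] Chains M' n) = ∑ σ : Fin (n + 1) → ι, F.single σ := by
  rw [chain, Fintype.piFinset_univ]

/-- Two independent sequences of labels are the same as one sequence of pairs. -/
theorem chain_comp_chain (n : ℕ) :
    (G.chain fun _ => univ).comp (F.chain fun _ => univ) =
      ((G.comp F).chain fun _ => univ : Chains M n →ₗ[k] Chains M n) := by
  refine chains_ext fun m a b => ?_
  simp only [LinearMap.comp_apply, chain_univ, LinearMap.sum_apply, map_sum]
  have h : ∀ g : (Fin (n + 1) → ι) → (Fin (n + 1) → κ) → Chains M n,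
      ∑ ρ, ∑ ρ', g ρ ρ' = ∑ σ : Fin (n + 1) → ι × κ, g (fun j => (σ j).1) fun j => (σ j).2 :=
    fun g => by
      rw [← Fintype.sum_prod_type']
      exact (Equiv.sum_comp (Equiv.arrowProdEquivProdArrow (Fin (n + 1)) (fun _ => ι) fun _ => κ)
        fun p => g p.1 p.2).symm
  simp only [single_elem, h]
  rfl

end Comp

variable (M) in
/-- The transfer from a bimodule to itself by multiplication with elements `y s` from the left
and `x s` from the right. -/
def inner {S : Type us} (x y : S → A) : Transfer M M S where
  η := AlgHom.id k B
  τ s s' := (LinearMap.mulLeft k (y s)).comp (LinearMap.mulRight k (x s'))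
  μ s s' := (Algebra.lsmul k k M.carrier (y s)).comp
    (Algebra.lsmul k k M.carrier (MulOpposite.op (x s')))
  τ_ε s s' β a := by
    simp only [LinearMap.comp_apply, LinearMap.mulLeft_apply, LinearMap.mulRight_apply,
      AlgHom.id_apply, ← mul_assoc, t.central β (y s)]

section

variable {S : Type us} (x y : S → A)

theorem inner_τ (s s' : S) (a : A) : (inner M x y).τ s s' a = y s * (a * x s') := rfl

theorem inner_μ (s s' : S) (m : M.carrier) :
    (inner M x y).μ s s' m = y s • MulOpposite.op (x s') • m := rfl

variable {x y}

/-- Between two neighbours the label `r` contributes `x r * y r`, and these products sum to `1`. -/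
theorem inner_complete {W : Finset S} (h : ∑ r ∈ W, x r * y r = 1) : (inner M x y).Complete W where
  mul s s' a a' := by
    have e : ∀ r, y s * (a * x r) * (y r * (a' * x s')) = y s * a * (x r * y r) * (a' * x s') :=
      fun r => by simp only [mul_assoc]
    simp only [inner_τ, e]
    rw [← Finset.sum_mul, ← Finset.mul_sum, h]
    simp only [mul_one, mul_assoc]
  right s s' a m := by
    have e : ∀ r, MulOpposite.op (y r * (a * x s')) • y s • MulOpposite.op (x r) • m =
        y s • MulOpposite.op (x r * y r * (a * x s')) • m := fun r => by
      rw [← smul_comm, smul_smul (MulOpposite.op _), ← MulOpposite.op_mul, mul_assoc]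
    have hop : ∑ r ∈ W, MulOpposite.op (x r * y r * (a * x s')) =
        MulOpposite.op (∑ r ∈ W, x r * y r * (a * x s')) :=
      (map_sum MulOpposite.opAddEquiv _ _).symm
    simp only [inner_τ, inner_μ, e]
    rw [← Finset.smul_sum, ← Finset.sum_smul, hop, ← Finset.sum_mul, h, one_mul,
      MulOpposite.op_mul, mul_smul]
  left s s' a m := by
    have e : ∀ r, (y s * (a * x r)) • y r • MulOpposite.op (x s') • m =
        (y s * a * (x r * y r)) • MulOpposite.op (x s') • m := fun r => by
      rw [smul_smul]
      simp only [mul_assoc]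
    simp only [inner_τ, inner_μ, e]
    rw [← Finset.sum_smul, ← Finset.mul_sum, h, mul_one, mul_smul, smul_comm a]

theorem inner_chain_singleton (s : S) (hx : x s = 1) (hy : y s = 1) (n : ℕ) :
    ((inner M x y).chain fun _ => {s} : Chains M n →ₗ[k] Chains M n) = LinearMap.id := by
  refine chains_ext fun m a b => ?_
  rw [chain, Fintype.piFinset_singleton, Finset.sum_singleton, single_elem]
  simp only [inner_τ, inner_μ, hx, hy, one_mul, mul_one, MulOpposite.op_one, one_smul,
    LinearMap.id_apply]
  rfl

/-- Identifies a full set of labels with a subset of a larger one, as needed after a label has been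
adjoined. -/
theorem inner_chain_comp {ι : Type ut} [Fintype ι] (e : ι ↪ S) (n : ℕ) :
    ((inner M (fun i => x (e i)) fun i => y (e i)).chain fun _ => univ :
      Chains M n →ₗ[k] Chains M n) = (inner M x y).chain fun _ => univ.map e := by
  rw [chain_univ, chain]
  refine Finset.sum_nbij (fun σ j => e (σ j)) ?_ ?_ ?_ ?_
  · intro σ _
    simp
  · intro σ _ σ' _ h
    exact funext fun j => e.injective (congrFun h j)
  · intro σ hσ
    have h : ∀ j, ∃ i, e i = σ j := by simpa using hσ
    choose ρ hρ using h
    exact ⟨ρ, by simp, funext hρ⟩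
  · intro σ _
    rfl

end

/-- Both the given labels and a single label with `x = y = 1` are complete in one common inner
transfer, so their chain maps are homotopic; the single label gives the identity. -/
theorem inner_chain_sub_mem {ι : Type us} [Fintype ι] {x y : ι → A} (h : ∑ i, x i * y i = 1)
    (n : ℕ) (z : Chains M n) (hz : z ∈ cycles M n) :
    ∃ w : Chains M (n + 1), boundary M n w = z - (inner M x y).chain (fun _ => univ) z := by
  -- `none` is the adjoined label with `x' = y' = 1`.
  let x' : Option ι → A := fun o => o.elim 1 x
  let y' : Option ι → A := fun o => o.elim 1 y
  obtain ⟨w, hw⟩ := (inner M x' y').chain_sub_chain_mem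
    (inner_complete (W := {none}) (by simp [x', y']))
    (inner_complete (W := univ.map Function.Embedding.some) (by simpa [x', y'] using h)) n z hz
  refine ⟨w, ?_⟩
  rw [hw, inner_chain_singleton none rfl rfl, ← inner_chain_comp]
  rfl

theorem homologyMap_homologyMap {ι : Type us} {κ : Type ut} [Fintype ι] [Fintype κ]
    {G : Transfer M' M κ} {F : Transfer M M' ι} (hG : G.Complete univ) (hF : F.Complete univ)
    {x y : ι × κ → A} (h : ∑ s, x s * y s = 1) (e : G.comp F = inner M x y) (n : ℕ)
    (z : Homology M n) : G.homologyMap hG n (F.homologyMap hF n z) = z := by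
  obtain ⟨⟨z, hz⟩, rfl⟩ := Submodule.mkQ_surjective _ z
  refine (Submodule.Quotient.eq _).2 ?_
  obtain ⟨w, hw⟩ := inner_chain_sub_mem h n z hz
  -- `w` bounds the cycle minus its image, whereas the quotient asks for the opposite difference.
  refine ⟨-w, Subtype.ext ?_⟩
  change boundary M n (-w) = G.chain (fun _ => univ) (F.chain (fun _ => univ) z) - z
  rw [map_neg, hw, neg_sub, ← e, ← chain_comp_chain]
  rfl

end Transfer

end Inner

/-! ### From bimodule isomorphisms to a strict Morita context -/

section Context

variable {k : Type uk} {R : Type ur} {S : Type us} {T : Type ut} [CommRing k] [Ring R] [Ring S]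
  [Ring T] [Algebra k R] [Algebra k S] [Algebra k T]

/-- The linear map on the balanced tensor product induced by a balanced bilinear map. -/
def Bimodule.lift {X : Bimodule.{uk, ur, us, ux} k R S} {Y : Bimodule.{uk, us, ut, uy} k S T}
    {Z : Type*} [AddCommGroup Z] [Module k Z] (L : X.carrier →ₗ[k] Y.carrier →ₗ[k] Z)
    (hL : ∀ x (s : S) y, L (MulOpposite.op s • x) y = L x (s • y)) : X.TensorCarrier Y →ₗ[k] Z :=
  Submodule.liftQ _ (TensorProduct.lift L) (by
    refine Submodule.span_le.2 ?_
    rintro _ ⟨x, s, y, rfl⟩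
    simp [hL])

theorem Bimodule.lift_tmul {X : Bimodule.{uk, ur, us, ux} k R S}
    {Y : Bimodule.{uk, us, ut, uy} k S T} {Z : Type*} [AddCommGroup Z] [Module k Z]
    (L : X.carrier →ₗ[k] Y.carrier →ₗ[k] Z)
    (hL : ∀ x (s : S) y, L (MulOpposite.op s • x) y = L x (s • y)) (x : X.carrier) (y : Y.carrier) :
    Bimodule.lift L hL (Bimodule.tmul x y) = L x y := 
  TensorProduct.lift.tmul x y

/-- There is no separate case for zero, because zero is itself the class of `0 ⊗ 0`. -/
theorem Bimodule.tensor_induction {X : Bimodule.{uk, ur, us, ux} k R S}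
    {Y : Bimodule.{uk, us, ut, uy} k S T} {p : X.TensorCarrier Y → Prop}
    (tmul : ∀ x y, p (Bimodule.tmul x y)) (add : ∀ z w, p z → p w → p (z + w))
    (z : X.TensorCarrier Y) : p z := by
  obtain ⟨z, rfl⟩ := Submodule.mkQ_surjective _ z
  induction z with
  | zero =>
    rw [← TensorProduct.zero_tmul X.carrier (0 : Y.carrier)]
    exact tmul 0 0
  | tmul x y => exact tmul x y
  | add z w hz hw =>
    rw [map_add]
    exact add _ _ hz hw

theorem Bimodule.exists_sum_tmul {X : Bimodule.{uk, ur, us, ux} k R S}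
    {Y : Bimodule.{uk, us, ut, uy} k S T} (z : X.TensorCarrier Y) :
    ∃ (n : ℕ) (x : Fin n → X.carrier) (y : Fin n → Y.carrier),
      ∑ i, Bimodule.tmul (x i) (y i) = z := by
  induction z using Bimodule.tensor_induction with
  | tmul x y => exact ⟨1, fun _ => x, fun _ => y, by simp⟩
  | add z w hz hw =>
    obtain ⟨n, x, y, rfl⟩ := hz
    obtain ⟨m, x', y', rfl⟩ := hw
    exact ⟨n + m, Fin.append x x', Fin.append y y', by simp [Fin.sum_univ_add]⟩

/-- A strict Morita context: compatible balanced pairings `f : P × Q → R` and `g : Q × P → S` with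
presentations of the units. -/
structure MoritaContext (P : Bimodule.{uk, ur, us, uP} k R S)
    (Q : Bimodule.{uk, us, ur, uQ} k S R) where
  /-- the pairing with values in `R` -/
  f : P.carrier →ₗ[k] Q.carrier →ₗ[k] R
  /-- the pairing with values in `S` -/
  g : Q.carrier →ₗ[k] P.carrier →ₗ[k] S
  f_left : ∀ (r : R) p q, f (r • p) q = r * f p q
  f_right : ∀ (r : R) p q, f p (MulOpposite.op r • q) = f p q * r
  f_balanced : ∀ (s : S) p q, f (MulOpposite.op s • p) q = f p (s • q)
  g_left : ∀ (s : S) q p, g (s • q) p = s * g q p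
  g_right : ∀ (s : S) q p, g q (MulOpposite.op s • p) = g q p * s
  g_balanced : ∀ (r : R) q p, g (MulOpposite.op r • q) p = g q (r • p)
  f_smul : ∀ p q p', f p q • p' = MulOpposite.op (g q p') • p
  g_smul : ∀ q p q', g q p • q' = MulOpposite.op (f p q') • q
  /-- the number of terms in the presentation of the unit of `R` -/
  fN : ℕ
  /-- the elements of `P` in the presentation of the unit of `R` -/
  fP : Fin fN → P.carrier
  /-- the elements of `Q` in the presentation of the unit of `R` -/
  fQ : Fin fN → Q.carrier
  f_one : ∑ i, f (fP i) (fQ i) = 1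
  /-- the number of terms in the presentation of the unit of `S` -/
  gN : ℕ
  /-- the elements of `Q` in the presentation of the unit of `S` -/
  gQ : Fin gN → Q.carrier
  /-- the elements of `P` in the presentation of the unit of `S` -/
  gP : Fin gN → P.carrier
  g_one : ∑ i, g (gQ i) (gP i) = 1

variable {P : Bimodule.{uk, ur, us, uP} k R S} {Q : Bimodule.{uk, us, ur, uQ} k S R}

namespace Bimodule.Iso

variable (e : Bimodule.Iso (P.tensor Q) (Bimodule.regular k R))

/-- The bilinear map `(p, q) ↦ e (p ⊗ q)`. -/
def pairing : P.carrier →ₗ[k] Q.carrier →ₗ[k] R :=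
  (TensorProduct.mk k P.carrier Q.carrier).compr₂ (e.toLin.toLinearMap ∘ₗ (P.tensorRel Q).mkQ)

theorem pairing_left (r : R) (p : P.carrier) (q : Q.carrier) :
    e.pairing (r • p) q = r * e.pairing p q :=
  e.map_left r (Bimodule.tmul p q : P.TensorCarrier Q)

theorem pairing_right (r : R) (p : P.carrier) (q : Q.carrier) :
    e.pairing p (MulOpposite.op r • q) = e.pairing p q * r :=
  e.map_right r (Bimodule.tmul p q : P.TensorCarrier Q)

theorem pairing_balanced (s : S) (p : P.carrier) (q : Q.carrier) :
    e.pairing (MulOpposite.op s • p) q = e.pairing p (s • q) :=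
  congrArg e.toLin (Bimodule.smul_tmul p s q)

theorem exists_pairing_one : ∃ (n : ℕ) (p : Fin n → P.carrier) (q : Fin n → Q.carrier),
    ∑ i, e.pairing (p i) (q i) = 1 := by
  obtain ⟨z, hz⟩ := e.toLin.surjective (1 : R)
  obtain ⟨n, p, q, rfl⟩ := Bimodule.exists_sum_tmul (X := P) (Y := Q) z
  exact ⟨n, p, q, (map_sum e.toLin _ _).symm.trans hz⟩

/-- A balanced map takes equal values on families with the same pairing. -/
theorem sum_eq_sum {ι κ : Type*} [Fintype ι] [Fintype κ] {p : ι → P.carrier} {q : ι → Q.carrier}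
    {p' : κ → P.carrier} {q' : κ → Q.carrier}
    (h : ∑ i, e.pairing (p i) (q i) = ∑ j, e.pairing (p' j) (q' j))
    {Z : Type*} [AddCommGroup Z] [Module k Z] (L : P.carrier →ₗ[k] Q.carrier →ₗ[k] Z)
    (hL : ∀ x (s : S) y, L (MulOpposite.op s • x) y = L x (s • y)) :
    ∑ i, L (p i) (q i) = ∑ j, L (p' j) (q' j) := by
  have hz : (∑ i, Bimodule.tmul (p i) (q i) : P.TensorCarrier Q) =
      ∑ j, Bimodule.tmul (p' j) (q' j) :=
    e.toLin.injective ((map_sum e.toLin _ _).trans (h.trans (map_sum e.toLin _ _).symm))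
  have := congrArg (Bimodule.lift L hL) hz
  simpa only [map_sum, Bimodule.lift_tmul] using this

theorem sum_eq {ι : Type*} [Fintype ι] {p : ι → P.carrier} {q : ι → Q.carrier}
    {p' : P.carrier} {q' : Q.carrier} (h : ∑ i, e.pairing (p i) (q i) = e.pairing p' q')
    {Z : Type*} [AddCommGroup Z] [Module k Z] (L : P.carrier →ₗ[k] Q.carrier →ₗ[k] Z)
    (hL : ∀ x (s : S) y, L (MulOpposite.op s • x) y = L x (s • y)) :
    ∑ i, L (p i) (q i) = L p' q' := by
  simpa using e.sum_eq_sum (p' := fun _ : Unit => p') (q' := fun _ : Unit => q')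
    (by simpa using h) L hL

theorem eq_of_pairing_eq {p p' : P.carrier} {q q' : Q.carrier}
    (h : e.pairing p q = e.pairing p' q') {Z : Type*} [AddCommGroup Z] [Module k Z]
    (L : P.carrier →ₗ[k] Q.carrier →ₗ[k] Z)
    (hL : ∀ x (s : S) y, L (MulOpposite.op s • x) y = L x (s • y)) : L p q = L p' q' := by
  simpa using e.sum_eq (p := fun _ : Unit => p) (q := fun _ : Unit => q) (by simpa using h) L hL

end Bimodule.Iso

namespace MoritaContext

/-- The context with the roles of the two algebras exchanged. -/
def swap (C : MoritaContext P Q) : MoritaContext Q P where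
  f := C.g
  g := C.f
  f_left := C.g_left
  f_right := C.g_right
  f_balanced := C.g_balanced
  g_left := C.f_left
  g_right := C.f_right
  g_balanced := C.f_balanced
  f_smul := C.g_smul
  g_smul := C.f_smul
  fN := C.gN
  fP := C.gQ
  fQ := C.gP
  f_one := C.g_one
  gN := C.fN
  gQ := C.fP
  gP := C.fQ
  g_one := C.f_one

variable (C : MoritaContext P Q)

/-- Here f(p,q'ⱼ) f(p'ⱼ,q) = f(f(p,q'ⱼ)p'ⱼ, q) = f(p g(q'ⱼ,p'ⱼ), q), and the values of g sum to `1`.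
This contraction yields the completeness of the labels and the relation Σ x_s y_s = 1 for the
composite. -/
theorem sum_f_mul_f (p : P.carrier) (q : Q.carrier) :
    ∑ j, C.f p (C.gQ j) * C.f (C.gP j) q = C.f p q := by
  simp only [← C.f_left, C.f_smul, C.f_balanced]
  rw [← map_sum, ← Finset.sum_smul, C.g_one, one_smul]

theorem sum_g_mul_g (q : Q.carrier) (p : P.carrier) :
    ∑ i, C.g q (C.fP i) * C.g (C.fQ i) p = C.g q p :=
  C.swap.sum_f_mul_f q p

/-- Bimodule isomorphisms `P ⊗ Q ≅ R` and `Q ⊗ P ≅ S` give rise to a strict Morita context: one of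
them can be changed so that they are compatible. -/
theorem nonempty_of_iso (e : Bimodule.Iso (P.tensor Q) (Bimodule.regular k R))
    (e' : Bimodule.Iso (Q.tensor P) (Bimodule.regular k S)) : Nonempty (MoritaContext P Q) := by
  obtain ⟨n, p, q, hpq⟩ := e.exists_pairing_one
  obtain ⟨n', q', p', hqp⟩ := e'.exists_pairing_one
  -- `L₁ z x y = x e'(y, z)` and `L₂ x y z = e(x, y) z`
  let L₁ : P.carrier → P.carrier →ₗ[k] Q.carrier →ₗ[k] P.carrier := fun z =>
    LinearMap.mk₂ k (fun x y => MulOpposite.op (e'.pairing y z) • x)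
      (fun _ _ _ => smul_add _ _ _) (fun _ _ _ => smul_comm _ _ _)
      (fun _ _ _ => by simp only [map_add, LinearMap.add_apply, MulOpposite.op_add, add_smul])
      (fun _ _ _ => by simp only [map_smul, LinearMap.smul_apply, MulOpposite.op_smul, smul_assoc])
  have hL₁ : ∀ z x (s : S) y, L₁ z (MulOpposite.op s • x) y = L₁ z x (s • y) := fun z x s y => by
    simp only [L₁, LinearMap.mk₂_apply, smul_smul, ← MulOpposite.op_mul, e'.pairing_left]
  let L₂ : P.carrier → Q.carrier →ₗ[k] P.carrier →ₗ[k] P.carrier := fun x =>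
    LinearMap.mk₂ k (fun y z => e.pairing x y • z)
      (fun _ _ _ => by simp only [map_add, add_smul])
      (fun _ _ _ => by simp only [map_smul, smul_assoc])
      (fun _ _ _ => smul_add _ _ _) (fun _ _ _ => smul_comm _ _ _)
  have hL₂ : ∀ x y (r : R) z, L₂ x (MulOpposite.op r • y) z = L₂ x y (r • z) := fun x y r z => by
    simp only [L₂, LinearMap.mk₂_apply, smul_smul, e.pairing_right]
  -- The maps e ⊗ id and id ⊗ e' from P ⊗ Q ⊗ P to P need not agree. `φ` is the automorphism that
  -- measures the difference, e(x,y)z ↦ x e'(y,z), evaluated on z = Σ e(pᵢ,qᵢ)z; `ψ` below is its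
  -- inverse.
  let φ : P.carrier → P.carrier := fun z => ∑ i, MulOpposite.op (e'.pairing (q i) z) • p i
  have hφ : ∀ x y z, φ (e.pairing x y • z) = MulOpposite.op (e'.pairing y z) • x := by
    intro x y z
    -- Since `e` is injective, Σ pᵢ ⊗ qᵢ e(x,y) = x ⊗ y in the balanced tensor product; the balanced
    -- map `L₁ z` is then applied.
    have h := e.sum_eq (p := p) (q := fun i => MulOpposite.op (e.pairing x y) • q i) (p' := x)
      (q' := y) (by simp only [e.pairing_right, ← Finset.sum_mul, hpq, one_mul]) (L₁ z) (hL₁ z)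
    simpa only [L₁, LinearMap.mk₂_apply, e'.pairing_balanced] using h
  have hφ_left : ∀ (r : R) z, φ (r • z) = r • φ z := by
    intro r z
    -- Both families have pairing `r`, so Σ pᵢ ⊗ qᵢ r = Σ r pᵢ ⊗ qᵢ: the preimage of the unit
    -- commutes with R.
    have h := e.sum_eq_sum (p := p) (q := fun i => MulOpposite.op r • q i) (p' := fun i => r • p i)
      (q' := q) (by simp only [e.pairing_right, e.pairing_left, ← Finset.sum_mul, ← Finset.mul_sum,
        hpq, one_mul, mul_one]) (L₁ z) (hL₁ z)
    simpa only [L₁, LinearMap.mk₂_apply, e'.pairing_balanced, ← smul_comm r,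
      ← Finset.smul_sum] using h
  have hφ_add : ∀ z w, φ (z + w) = φ z + φ w := fun z w => by
    simp only [φ, map_add, MulOpposite.op_add, add_smul, Finset.sum_add_distrib]
  let ψ : P.carrier →ₗ[k] P.carrier :=
    { toFun := fun x => ∑ j, e.pairing x (q' j) • p' j
      map_add' := fun x y => by
        simp only [map_add, LinearMap.add_apply, add_smul, Finset.sum_add_distrib]
      map_smul' := fun c x => by
        simp only [map_smul, LinearMap.smul_apply, smul_assoc, ← Finset.smul_sum,
          RingHom.id_apply] }
  have hψ_apply : ∀ x, ψ x = ∑ j, e.pairing x (q' j) • p' j := fun _ => rfl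
  have hψ_left : ∀ (r : R) x, ψ (r • x) = r • ψ x := fun r x => by
    simp only [hψ_apply, e.pairing_left, mul_smul, ← Finset.smul_sum]
  have hψ : ∀ x y z, ψ (MulOpposite.op (e'.pairing y z) • x) = e.pairing x y • z := by
    intro x y z
    have h := e'.sum_eq (p := fun j => e'.pairing y z • q' j) (q := p') (p' := y)
      (q' := z) (by simp only [e'.pairing_left, ← Finset.mul_sum, hqp, mul_one]) (L₂ x) (hL₂ x)
    simpa only [hψ_apply, L₂, LinearMap.mk₂_apply, ← e.pairing_balanced] using h
  have hψ_right : ∀ (s : S) x, ψ (MulOpposite.op s • x) = MulOpposite.op s • ψ x := by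
    intro s x
    have h := e'.sum_eq_sum (p := fun j => s • q' j) (q := p') (p' := q')
      (q' := fun j => MulOpposite.op s • p' j) (by simp only [e'.pairing_right, e'.pairing_left,
        ← Finset.sum_mul, ← Finset.mul_sum, hqp, one_mul, mul_one]) (L₂ x) (hL₂ x)
    simpa only [hψ_apply, L₂, LinearMap.mk₂_apply, ← e.pairing_balanced,
      smul_comm _ (MulOpposite.op s), ← Finset.smul_sum] using h
  have hφψ : ∀ x, φ (ψ x) = x := by
    intro x
    let φ' : P.carrier →+ P.carrier := AddMonoidHom.mk' φ hφ_add
    have h : φ' (ψ x) = x := by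
      rw [hψ_apply, map_sum]
      change ∑ j, φ (e.pairing x (q' j) • p' j) = x
      simp only [hφ]
      rw [← Finset.sum_smul]
      have : ∑ j, MulOpposite.op (e'.pairing (q' j) (p' j)) =
          MulOpposite.op (∑ j, e'.pairing (q' j) (p' j)) :=
        (map_sum MulOpposite.opAddEquiv _ _).symm
      rw [this, hqp, MulOpposite.op_one, one_smul]
    exact h
  have hψφ : ∀ x, ψ (φ x) = x := by
    intro x
    simp only [φ, map_sum, hψ]
    rw [← Finset.sum_smul, hpq, one_smul]
  -- Twisting e' by `ψ` gives the first compatibility: x e'(y, ψ z) = φ(e(x,y) ψ z) = e(x,y) z.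
  let g : Q.carrier →ₗ[k] P.carrier →ₗ[k] S := e'.pairing.compl₂ ψ
  have g_apply : ∀ y z, g y z = e'.pairing y (ψ z) := fun _ _ => rfl
  have f_smul : ∀ x y z, e.pairing x y • z = MulOpposite.op (g y z) • x := fun x y z => by
    rw [g_apply, ← hφ, hφ_left, hφψ]
  have g_right : ∀ (s : S) y z, g y (MulOpposite.op s • z) = g y z * s := fun s y z => by
    rw [g_apply, g_apply, hψ_right, e'.pairing_right]
  have g_one : ∑ j, g (q' j) (φ (p' j)) = 1 := by
    simp only [g_apply, hψφ, hqp]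
  have g_left : ∀ (s : S) y z, g (s • y) z = s * g y z := fun s y z => e'.pairing_left s y (ψ z)
  refine ⟨⟨e.pairing, g, e.pairing_left, e.pairing_right, e.pairing_balanced, g_left, g_right,
    fun r y z => ?_, f_smul, fun y z w => ?_, n, p, q, hpq, n', q', fun j => φ (p' j), g_one⟩⟩
  · rw [g_apply, g_apply, hψ_left, e'.pairing_balanced]
  -- The second compatibility follows from the first. Both x₁ ⊗ g(y,z)w and x₁ ⊗ y e(z,w) have
  -- pairing e(x₁,y) e(z,w), hence coincide; applying g(y₁, –) and summing over a presentation of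
  -- the unit removes x₁ and y₁.
  · have key : ∀ y₁ x₁, g y₁ x₁ • g y z • w = g y₁ x₁ • MulOpposite.op (e.pairing z w) • y := by
      intro y₁ x₁
      let L₃ : P.carrier →ₗ[k] Q.carrier →ₗ[k] Q.carrier :=
        LinearMap.mk₂ k (fun x v => g y₁ x • v)
          (fun _ _ _ => by simp only [map_add, add_smul])
          (fun _ _ _ => by simp only [map_smul, smul_assoc])
          (fun _ _ _ => smul_add _ _ _) (fun _ _ _ => smul_comm _ _ _)
      exact e.eq_of_pairing_eq (by
        rw [← e.pairing_balanced, ← f_smul, e.pairing_left, e.pairing_right]) L₃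
        (fun x s v => by simp only [L₃, LinearMap.mk₂_apply, g_right, mul_smul])
    have h := Finset.sum_congr rfl fun j (_ : j ∈ Finset.univ) => key (q' j) (φ (p' j))
    rwa [← Finset.sum_smul, ← Finset.sum_smul, g_one, one_smul, one_smul] at h

end MoritaContext

end Context

/-! ### The transfers between M and Q ⊗ M ⊗ P and the isomorphism -/

section Morita

variable {k : Type uk} {A : Type uA} {B : Type uB} {A' : Type uA'} {B' : Type uB'}
  [CommRing k] [Ring A] [CommRing B] [Algebra k A] [Algebra k B]
  [Ring A'] [CommRing B'] [Algebra k A'] [Algebra k B']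
  {t : Triple k A B} {t' : Triple k A' B'}

namespace MoritaEquivalence

variable (E : MoritaEquivalence.{uk, uA, uB, uA', uB', uP, uQ} t t') (C : MoritaContext E.P E.Q)

/-- The class of `q ⊗ m ⊗ p` in `Q ⊗ M ⊗ P`. -/
def conjElem (M : SymBimodule.{uk, uA, uB, uM} t) (q : E.Q.carrier) (m : M.carrier)
    (p : E.P.carrier) : (E.conj M).carrier :=
  (Bimodule.tmul (Bimodule.tmul q m : E.Q.TensorCarrier M.toBimodule) p :
    (E.Q.tensor M.toBimodule).TensorCarrier E.P)

section

variable {E} {M : SymBimodule.{uk, uA, uB, uM} t}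

theorem conj_induction {r : (E.conj M).carrier → Prop} (elem : ∀ q m p, r (E.conjElem M q m p))
    (add : ∀ z w, r z → r w → r (z + w)) (z : (E.conj M).carrier) : r z := by
  refine Bimodule.tensor_induction (X := E.Q.tensor M.toBimodule) (Y := E.P)
    (fun y p => ?_) add z
  refine Bimodule.tensor_induction (X := E.Q) (Y := M.toBimodule)
    (p := fun y => r (Bimodule.tmul (X := E.Q.tensor M.toBimodule) (Y := E.P) y p))
    (fun q m => elem q m p) (fun y y' h h' => ?_) y
  have e := Bimodule.add_tmul (X := E.Q.tensor M.toBimodule) (Y := E.P) y y' p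
  exact e ▸ add _ _ h h'

theorem left_smul_conjElem (a' : A') (q : E.Q.carrier) (m : M.carrier) (p : E.P.carrier) :
    a' • E.conjElem M q m p = E.conjElem M (a' • q) m p := rfl

theorem right_smul_conjElem (a' : A') (q : E.Q.carrier) (m : M.carrier) (p : E.P.carrier) :
    MulOpposite.op a' • E.conjElem M q m p = E.conjElem M q m (MulOpposite.op a' • p) := rfl

theorem conjElem_smul_left (a : A) (q : E.Q.carrier) (m : M.carrier) (p : E.P.carrier) :
    E.conjElem M (MulOpposite.op a • q) m p = E.conjElem M q (a • m) p :=
  congrArg (fun y => (Bimodule.tmul y p : (E.Q.tensor M.toBimodule).TensorCarrier E.P))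
    (Bimodule.smul_tmul q a m)

theorem conjElem_smul_right (a : A) (q : E.Q.carrier) (m : M.carrier) (p : E.P.carrier) :
    E.conjElem M q m (a • p) = E.conjElem M q (MulOpposite.op a • m) p :=
  (Bimodule.smul_tmul (X := E.Q.tensor M.toBimodule) (Y := E.P)
    (Bimodule.tmul q m : E.Q.TensorCarrier M.toBimodule) a p).symm

variable (E M) in
/-- The linear map `m ↦ q ⊗ m ⊗ p`. -/
def conjLin (q : E.Q.carrier) (p : E.P.carrier) : M.carrier →ₗ[k] (E.conj M).carrier where
  toFun m := E.conjElem M q m p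
  map_add' m m' := by
    rw [conjElem, Bimodule.tmul_add]
    exact Bimodule.add_tmul (X := E.Q.tensor M.toBimodule) (Y := E.P) _ _ p
  map_smul' c m := by
    rw [conjElem, Bimodule.tmul_ksmul]
    exact Bimodule.ksmul_tmul (X := E.Q.tensor M.toBimodule) (Y := E.P) c _ p

theorem sum_conjElem_left {ι : Type*} (s : Finset ι) (q : ι → E.Q.carrier) (m : M.carrier)
    (p : E.P.carrier) : ∑ i ∈ s, E.conjElem M (q i) m p = E.conjElem M (∑ i ∈ s, q i) m p := by
  let h : E.Q.carrier →+ (E.conj M).carrier := AddMonoidHom.mk' (fun q => E.conjElem M q m p)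
    fun q q' => by
      rw [conjElem, Bimodule.add_tmul]
      exact Bimodule.add_tmul (X := E.Q.tensor M.toBimodule) (Y := E.P) _ _ p
  exact (map_sum h q s).symm

theorem sum_conjElem_right {ι : Type*} (s : Finset ι) (q : E.Q.carrier) (m : M.carrier)
    (p : ι → E.P.carrier) : ∑ i ∈ s, E.conjElem M q m (p i) = E.conjElem M q m (∑ i ∈ s, p i) := by
  let h : E.P.carrier →+ (E.conj M).carrier := AddMonoidHom.mk' (fun p => E.conjElem M q m p)
    fun p p' => Bimodule.tmul_add (X := E.Q.tensor M.toBimodule) (Y := E.P) _ p p'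
  exact (map_sum h p s).symm

end

variable {E}

theorem exists_context : Nonempty (MoritaContext E.P E.Q) :=
  MoritaContext.nonempty_of_iso E.f E.g

section Transfers

variable (M : SymBimodule.{uk, uA, uB, uM} t)

/-- The transfer from `M` to `Q ⊗ M ⊗ P`. -/
def toConj : Transfer M (E.conj M) (Fin C.fN) where
  η := E.η.toAlgHom
  τ i i' := (C.g (C.fQ i)).comp ((Algebra.lsmul k k E.P.carrier).toLinearMap.flip (C.fP i'))
  μ i i' := E.conjLin M (C.fQ i) (C.fP i')
  τ_ε i i' β a := by
    change C.g (C.fQ i) ((t.ε β * a) • C.fP i') = t'.ε (E.η β) * C.g (C.fQ i) (a • C.fP i')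
    -- The factor ε(β) moves across the pairing onto Q, where it becomes the left action of ε'(η β).
    rw [mul_smul, ← C.g_balanced, E.symm_Q, C.g_left]

theorem toConj_τ (i i' : Fin C.fN) (a : A) :
    (toConj C M).τ i i' a = C.g (C.fQ i) (a • C.fP i') := rfl

theorem toConj_μ (i i' : Fin C.fN) (m : M.carrier) :
    (toConj C M).μ i i' m = E.conjElem M (C.fQ i) m (C.fP i') := rfl

/-- For `mul` the label is contracted by `sum_g_mul_g`. For the actions the compatibility of f and g
rewrites p_r g(q_r, a p) as f(p_r,q_r) a p, and g(q, a p_r) q_r as q a f(p_r,q_r); the presentation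
of the unit then gives `1`. -/
theorem toConj_complete : (toConj C M).Complete Finset.univ where
  mul i i' a a' := by
    simp only [toConj_τ]
    have e : ∀ r, C.g (C.fQ i) (a • C.fP r) = C.g (MulOpposite.op a • C.fQ i) (C.fP r) :=
      fun r => (C.g_balanced _ _ _).symm
    simp only [e]
    rw [C.sum_g_mul_g, C.g_balanced, mul_smul]
  right i i' a m := by
    simp only [toConj_τ, toConj_μ, right_smul_conjElem, ← C.f_smul]
    rw [sum_conjElem_right, ← Finset.sum_smul, C.f_one, one_smul, conjElem_smul_right]
  left i i' a m := by
    simp only [toConj_τ, toConj_μ, left_smul_conjElem, C.g_smul, C.f_left]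
    have e : ∀ r, MulOpposite.op (a * C.f (C.fP r) (C.fQ r)) • C.fQ i =
        MulOpposite.op (C.f (C.fP r) (C.fQ r)) • MulOpposite.op a • C.fQ i := fun r => by
      rw [MulOpposite.op_mul, mul_smul]
    have hop : ∑ r, MulOpposite.op (C.f (C.fP r) (C.fQ r)) =
        MulOpposite.op (∑ r, C.f (C.fP r) (C.fQ r)) := (map_sum MulOpposite.opAddEquiv _ _).symm
    simp only [e]
    rw [sum_conjElem_left, ← Finset.sum_smul, hop, C.f_one, MulOpposite.op_one, one_smul,
      conjElem_smul_left]

/-- The linear map `q ⊗ m ↦ f(p', q) m`. -/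
def leftEval (p' : E.P.carrier) : (E.Q.tensor M.toBimodule).carrier →ₗ[k] M.carrier :=
  Bimodule.lift (X := E.Q) (Y := M.toBimodule)
    (LinearMap.mk₂ k (fun q (m : M.carrier) => C.f p' q • m)
      (fun _ _ _ => by simp only [map_add, add_smul])
      (fun _ _ _ => by simp only [map_smul, smul_assoc])
      (fun _ _ _ => smul_add _ _ _) (fun _ _ _ => smul_comm _ _ _))
    (fun q a m => by
      rw [LinearMap.mk₂_apply, LinearMap.mk₂_apply, C.f_right, mul_smul])

/-- Evaluation on the left commutes with the right action, which makes the two-sided evaluation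
balanced over `A`. -/
theorem leftEval_right (p' : E.P.carrier) (a : A) (y : (E.Q.tensor M.toBimodule).carrier) :
    leftEval C M p' (MulOpposite.op a • y) = MulOpposite.op a • leftEval C M p' y := by
  induction y using Bimodule.tensor_induction with
  | tmul q m => exact smul_comm _ _ _
  | add z w hz hw =>
    exact (congrArg _ (smul_add _ _ _)).trans <| (map_add _ _ _).trans <|
      (congrArg₂ _ hz hw).trans <| (smul_add _ _ _).symm.trans <| congrArg _ (map_add _ _ _).symm

/-- The linear map `q ⊗ m ⊗ p ↦ f(p', q) m f(p, q')`. -/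
def conjEval (p' : E.P.carrier) (q' : E.Q.carrier) : (E.conj M).carrier →ₗ[k] M.carrier :=
  Bimodule.lift (X := E.Q.tensor M.toBimodule) (Y := E.P)
    (LinearMap.mk₂ k (fun y p => MulOpposite.op (C.f p q') • leftEval C M p' y)
      (fun _ _ _ => by rw [map_add, smul_add])
      (fun _ _ _ => by rw [map_smul, smul_comm])
      (fun _ _ _ => by rw [map_add, LinearMap.add_apply, MulOpposite.op_add, add_smul])
      (fun _ _ _ => by rw [map_smul, LinearMap.smul_apply, MulOpposite.op_smul, smul_assoc]))
    (fun y a p => by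
      rw [LinearMap.mk₂_apply, LinearMap.mk₂_apply, leftEval_right, C.f_left, MulOpposite.op_mul,
        mul_smul])

theorem conjEval_conjElem (p' : E.P.carrier) (q' : E.Q.carrier) (q : E.Q.carrier) (m : M.carrier)
    (p : E.P.carrier) : conjEval C M p' q' (E.conjElem M q m p) =
      MulOpposite.op (C.f p q') • C.f p' q • m := rfl

/-- The transfer from `Q ⊗ M ⊗ P` to `M`. -/
def ofConj : Transfer (E.conj M) M (Fin C.gN) where
  η := E.η.symm.toAlgHom
  τ j j' := (C.f (C.gP j)).comp ((Algebra.lsmul k k E.Q.carrier).toLinearMap.flip (C.gQ j'))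
  μ j j' := conjEval C M (C.gP j) (C.gQ j')
  τ_ε j j' β a := by
    obtain ⟨β, rfl⟩ := E.η.surjective β
    change C.f (C.gP j) ((t'.ε (E.η β) * a) • C.gQ j') =
      t.ε (E.η.symm (E.η β)) * C.f (C.gP j) (a • C.gQ j')
    rw [mul_smul, ← C.f_balanced, ← E.symm_P, C.f_left, E.η.symm_apply_apply]

theorem ofConj_τ (j j' : Fin C.gN) (a : A') :
    (ofConj C M).τ j j' a = C.f (C.gP j) (a • C.gQ j') := rfl

theorem ofConj_μ (j j' : Fin C.gN) (q : E.Q.carrier) (m : M.carrier) (p : E.P.carrier) :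
    (ofConj C M).μ j j' (E.conjElem M q m p) =
      MulOpposite.op (C.f p (C.gQ j')) • C.f (C.gP j) q • m :=
  conjEval_conjElem C M _ _ q m p

theorem ofConj_complete : (ofConj C M).Complete Finset.univ where
  mul j j' a a' := by
    have e : ∀ r, C.f (C.gP j) (a • C.gQ r) = C.f (MulOpposite.op a • C.gP j) (C.gQ r) :=
      fun r => (C.f_balanced _ _ _).symm
    simp only [ofConj_τ, e]
    rw [C.sum_f_mul_f, C.f_balanced, mul_smul]
  right j j' a z := by
    induction z using conj_induction with
    | elem q m p =>
      simp only [right_smul_conjElem, ofConj_μ, ofConj_τ, smul_smul (MulOpposite.op _),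
        ← MulOpposite.op_mul]
      have hop : ∑ r, MulOpposite.op (C.f p (C.gQ r) * C.f (C.gP r) (a • C.gQ j')) =
          MulOpposite.op (∑ r, C.f p (C.gQ r) * C.f (C.gP r) (a • C.gQ j')) :=
        (map_sum MulOpposite.opAddEquiv _ _).symm
      rw [← Finset.sum_smul, hop, C.sum_f_mul_f, C.f_balanced]
    | add z w hz hw => simp only [smul_add, map_add, Finset.sum_add_distrib, hz, hw]
  left j j' a z := by
    induction z using conj_induction with
    | elem q m p =>
      simp only [left_smul_conjElem, ofConj_μ, ofConj_τ, smul_comm (C.f _ (_ • _)), smul_smul]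
      rw [← Finset.smul_sum, ← Finset.sum_smul]
      simp only [← C.f_balanced]
      rw [C.sum_f_mul_f]
    | add z w hz hw => simp only [smul_add, map_add, Finset.sum_add_distrib, hz, hw]

/-- The compatibility of the pairings factors the composite: f(p', g(q, a p) q') = f(p', q f(a p,
q')) = f(p', q) a f(p, q'). -/
theorem ofConj_comp_toConj : (ofConj C M).comp (toConj C M) =
    Transfer.inner M (fun s => C.f (C.fP s.1) (C.gQ s.2)) fun s => C.f (C.gP s.2) (C.fQ s.1) := by
  refine Transfer.ext ?_ ?_ ?_
  · exact AlgHom.ext E.η.symm_apply_apply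
  · refine funext fun s => funext fun s' => LinearMap.ext fun a => ?_
    change C.f (C.gP s.2) (C.g (C.fQ s.1) (a • C.fP s'.1) • C.gQ s'.2) =
      C.f (C.gP s.2) (C.fQ s.1) * (a * C.f (C.fP s'.1) (C.gQ s'.2))
    rw [C.g_smul, C.f_right, C.f_left]
  · refine funext fun s => funext fun s' => LinearMap.ext fun m => ?_
    exact (ofConj_μ C M _ _ _ _ _).trans (smul_comm _ _ _).symm

theorem toConj_comp_ofConj : (toConj C M).comp (ofConj C M) =
    Transfer.inner (E.conj M) (fun s => C.g (C.gQ s.1) (C.fP s.2))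
      fun s => C.g (C.fQ s.2) (C.gP s.1) := by
  refine Transfer.ext ?_ ?_ ?_
  · exact AlgHom.ext E.η.apply_symm_apply
  · refine funext fun s => funext fun s' => LinearMap.ext fun a => ?_
    change C.g (C.fQ s.2) (C.f (C.gP s.1) (a • C.gQ s'.1) • C.fP s'.2) =
      C.g (C.fQ s.2) (C.gP s.1) * (a * C.g (C.gQ s'.1) (C.fP s'.2))
    rw [C.f_smul, C.g_right, C.g_left]
  · refine funext fun s => funext fun s' => LinearMap.ext fun z => ?_
    induction z using conj_induction with
    | elem q m p =>
      change (toConj C M).μ s.2 s'.2 ((ofConj C M).μ s.1 s'.1 (E.conjElem M q m p)) =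
        C.g (C.fQ s.2) (C.gP s.1) • MulOpposite.op (C.g (C.gQ s'.1) (C.fP s'.2)) •
          E.conjElem M q m p
      rw [ofConj_μ, toConj_μ, right_smul_conjElem, left_smul_conjElem, C.g_smul, ← C.f_smul,
        conjElem_smul_left, conjElem_smul_right]
    | add z w hz hw => rw [map_add, map_add, hz, hw]

/-- The isomorphism between the secondary Hochschild homologies with coefficients in `M` and in
`Q ⊗ M ⊗ P`. -/
def homologyEquiv (n : ℕ) : Homology M n ≃ₗ[k] Homology (E.conj M) n :=
  LinearEquiv.ofLinearMap ((toConj C M).homologyMap (toConj_complete C M) n)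
    ((ofConj C M).homologyMap (ofConj_complete C M) n)
    (LinearMap.ext fun z => Transfer.homologyMap_homologyMap (toConj_complete C M)
      (ofConj_complete C M) (by
      -- The double sum of the products x_s y_s contracts over the second label to the presentation
      -- of the unit.
      rw [Fintype.sum_prod_type]
      simp only [C.sum_g_mul_g, C.g_one]) (toConj_comp_ofConj C M) n z)
    (LinearMap.ext fun z => Transfer.homologyMap_homologyMap (ofConj_complete C M)
      (toConj_complete C M) (by
      rw [Fintype.sum_prod_type]
      simp only [C.sum_f_mul_f, C.f_one]) (ofConj_comp_toConj C M) n z)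

variable {M} {N : SymBimodule.{uk, uA, uB, uN} t}

/-- The entries of the matrix do not involve the coefficients, and on q ⊗ m ⊗ p the map id ⊗ u ⊗ id
acts on m alone; the square commutes label by label. -/
theorem chain_toConj_chainsMap (u : Bimodule.Hom M.toBimodule N.toBimodule) (n : ℕ) :
    ((toConj C N).chain fun _ => Finset.univ).comp (chainsMap u n) =
      (chainsMap (E.conjMap u) n).comp ((toConj C M).chain fun _ => Finset.univ) := by
  refine chains_ext fun m a b => ?_
  simp only [LinearMap.comp_apply, Transfer.chain, LinearMap.sum_apply, map_sum, chainsMap_elem,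
    Transfer.single_elem]
  rfl

theorem homologyEquiv_homologyMap (u : Bimodule.Hom M.toBimodule N.toBimodule) (n : ℕ)
    (z : Homology M n) : homologyEquiv C N n (homologyMap u n z) =
      homologyMap (E.conjMap u) n (homologyEquiv C M n z) := by
  obtain ⟨⟨z, hz⟩, rfl⟩ := Submodule.mkQ_surjective _ z
  refine congrArg (Submodule.mkQ (LinearMap.range (boundaryToCycles (E.conj N) n)))
    (Subtype.ext ?_)
  exact LinearMap.congr_fun (chain_toConj_chainsMap C u n) z

end Transfers

end MoritaEquivalence

end Morita

end SecHH

theorem theorem2p6 {k : Type uk} {A : Type uA} {B : Type uB} {A' : Type uA'} {B' : Type uB'}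
    [Field k] [Ring A] [CommRing B] [Algebra k A] [Algebra k B]
    [Ring A'] [CommRing B'] [Algebra k A'] [Algebra k B']
    (t : SecHH.Triple k A B) (t' : SecHH.Triple k A' B')
    (E : SecHH.MoritaEquivalence.{uk, uA, uB, uA', uB', uP, uQ} t t') :
    ∃ Φ : ∀ (n : ℕ) (M : SecHH.SymBimodule.{uk, uA, uB, uM} t),
        SecHH.Homology M n ≃ₗ[k] SecHH.Homology (E.conj M) n,
      ∀ (n : ℕ) (M N : SecHH.SymBimodule.{uk, uA, uB, uM} t)
        (u : SecHH.Bimodule.Hom M.toBimodule N.toBimodule) (z : SecHH.Homology M n),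
        Φ n N (SecHH.homologyMap u n z) = SecHH.homologyMap (E.conjMap u) n (Φ n M z) := by
  -- The context depends only on the equivalence. It is chosen once, before `n` and `M`, so that the
  -- isomorphisms for different bimodules use the same labels and are natural.
  obtain ⟨C⟩ := SecHH.MoritaEquivalence.exists_context (E := E)
  exact ⟨fun n M => SecHH.MoritaEquivalence.homologyEquiv C M n,
    fun n M N u z => SecHH.MoritaEquivalence.homologyEquiv_homologyMap C u n z⟩
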